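/- Let $d\ge 2$, $\alpha=\frac{2}{d-1}$, let $q\in\mathbb S^{d-1}$ be fixed and let $V\in\mathbb R^{d\times d}$. Let $x_1,x_2,\dots$ be i.i.d. random points of $\mathbb S^{d-1}$ with common law $\rho\,d\sigma$, where $\sigma$ is the (unnormalized) surface measure on $\mathbb S^{d-1}$ and the density $\rho\ge 0$ is $C^2$ on $\mathbb S^{d-1}$ with $\rho(q)>0$. For a real sequence $(\beta_n)$ put $$A_j=\frac{e^{\beta_n\langle q,x_j\rangle}}{\sum_{l=1}^n e^{\beta_n\langle q,x_l\rangle}}\quad(1\le j\le n),\qquad \mathsf{ATT}(n)=V\sum_{j=1}^n A_jx_j,\qquad \mathcal Y_n(q)=\mathsf{ATT}(n)-Vq,$$ and $$\mathcal Y(q)=\nabla_{\mathbb S^{d-1}}\log\rho(q)-\tfrac{d-1}{2}\,q,\qquad \Sigma(q)=\frac{c_d}{\rho(q)}\bigl(\mathrm{Id}-qq^{\top}\bigr),\qquad c_d=2^{-d}\pi^{-(d-1)/2},$$ where $\nabla_{\mathbb S^{d-1}}$ is the spherical gradient, regarded as a vector of $\mathbb R^d$ orthogonal to $q$. Assume that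 $\beta_n\to\infty$ and $\beta_n n^{-\alpha}\to0$ as $n\to\infty$. 1. If $\beta_n^{1+\alpha}n^{-\alpha}\to0$, then $\beta_n\mathcal Y_n(q)\to V\mathcal Y(q)$ in probability. 2. If $\beta_n^{1+\alpha}n^{-\alpha}\to\tau\in(0,\infty)$, then $\beta_n\mathcal Y_n(q)\to V\mathcal Y(q)+G_\tau$ in distribution, where $G_\tau\sim\mathcal N\bigl(0,\tau^{1/\alpha}V\Sigma(q)V^{\top}\bigr)$. 3. If $\beta_n^{1+\alpha}n^{-\alpha}\to\infty$, then $\sqrt{n\beta_n^{1-1/\alpha}}\;\mathcal Y_n(q)\to G_1$ in distribution, where $G_1\sim\mathcal N\bigl(0,V\Sigma(q)V^{\top}\bigr)$. Moreover, under the assumptions $\beta_n\to\infty$ and $\beta_nn^{-\alpha}\to0$ alone (hence in all three regimes), $\mathcal Y_n(q)\to0$ and $\mathsf{ATT}(n)\to Vq$ in probability. -/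

import Mathlib

open MeasureTheory ProbabilityTheory Filter Topology Manifold

noncomputable section

/-- The Euclidean space `ℝ^d`. -/
abbrev Euc (d : ℕ) : Type := EuclideanSpace ℝ (Fin d)

/-- The unit sphere `S^{d-1}` of `ℝ^d`. -/
abbrev USphere (d : ℕ) : Type := Metric.sphere (0 : Euc d) 1

/-- The (unnormalized) surface measure on `S^{d-1}`. -/
def surfaceMeasure (d : ℕ) : Measure (USphere d) :=
  (volume : Measure (Euc d)).toSphere

/-- The measure `ρ dσ` on `S^{d-1}`. -/
def keyLaw {d : ℕ} (ρ : USphere d → ℝ) : Measure (USphere d) :=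
  (surfaceMeasure d).withDensity fun x => ENNReal.ofReal (ρ x)

/-- The local exponent `α = 2 / (d - 1)`. -/
def alphaExp (d : ℕ) : ℝ := 2 / ((d : ℝ) - 1)

/-- Softmax attention weight of the key `x j` among the `n` keys `x 0, …, x (n - 1)`, for the
query `q` and the inverse temperature `β`. -/
def attnWeight {d : ℕ} (β : ℝ) (q : USphere d) (x : ℕ → USphere d) (n j : ℕ) : ℝ :=
  Real.exp (β * inner ℝ (q : Euc d) (x j : Euc d)) /
    ∑ l ∈ Finset.range n, Real.exp (β * inner ℝ (q : Euc d) (x l : Euc d))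

/-- The attention output `ATT(n) = V ∑_j A_j x_j`. -/
def attnOutput {d : ℕ} (β : ℝ) (V : Matrix (Fin d) (Fin d) ℝ) (q : USphere d)
    (x : ℕ → USphere d) (n : ℕ) : Euc d :=
  Matrix.toEuclideanCLM (𝕜 := ℝ) V
    (∑ j ∈ Finset.range n, attnWeight β q x n j • (x j : Euc d))

/-- The output displacement `ATT(n) - V q`. -/
def attnDisplacement {d : ℕ} (β : ℝ) (V : Matrix (Fin d) (Fin d) ℝ) (q : USphere d)
    (x : ℕ → USphere d) (n : ℕ) : Euc d :=
  attnOutput β V q x n - Matrix.toEuclideanCLM (𝕜 := ℝ) V (q : Euc d)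

/-- The extension of a function on the sphere to `ℝ^d ∖ {0}`, constant along rays
(with the value `0` at the origin). -/
def radialExtension {d : ℕ} (f : USphere d → ℝ) (x : Euc d) : ℝ :=
  if hx : x = 0 then 0
  else f ⟨‖x‖⁻¹ • x, by simp [norm_smul, inv_mul_cancel₀ (norm_ne_zero_iff.mpr hx)]⟩

/-- The spherical gradient at `q`, as a vector of `ℝ^d` (tangent to the sphere at `q`): the
Euclidean gradient at `q` of the extension that is constant along rays. -/
def sphericalGradient {d : ℕ} (f : USphere d → ℝ) (q : USphere d) : Euc d :=
  gradient (radialExtension f) (q : Euc d)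

/-- The drift `∇ log ρ(q) - ((d - 1) / 2) q`. -/
def attnDrift {d : ℕ} (ρ : USphere d → ℝ) (q : USphere d) : Euc d :=
  sphericalGradient (fun x => Real.log (ρ x)) q - (((d : ℝ) - 1) / 2) • (q : Euc d)

/-- The constant `c_d = 2^{-d} π^{-(d-1)/2}`. -/
def covConst (d : ℕ) : ℝ := (2 : ℝ) ^ (-(d : ℝ)) * Real.pi ^ (-((d : ℝ) - 1) / 2)

/-- The matrix `P_q = Id - q qᵀ` of the orthogonal projection onto the tangent space at `q`. -/
def tangentProj {d : ℕ} (q : USphere d) : Matrix (Fin d) (Fin d) ℝ :=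
  1 - Matrix.vecMulVec (fun i => (q : Euc d) i) (fun i => (q : Euc d) i)

/-- The covariance `Σ(q) = (c_d / ρ(q)) P_q`. -/
def attnCov {d : ℕ} (ρ : USphere d → ℝ) (q : USphere d) : Matrix (Fin d) (Fin d) ℝ :=
  (covConst d / ρ q) • tangentProj q

end

open scoped RealInnerProductSpace
open NormedSpace (normalize)

/-!
Since `⟪q, x⟫ = 1 - ‖x - q‖² / 2` on the sphere, the softmax weights are, up to a common factor, the
Gaussian weights `exp (-β ‖x - q‖² / 2)` of width `β ^ (-1/2)`, so `ATT n - V q` is `V` applied to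
the ratio of an i.i.d. sum of vectors `w (x - q)` and an i.i.d. sum of weights `w`. Multiplying by a
radial Gaussian and using polar coordinates turns a weighted sphere integral into a Gaussian
integral over the whole space, which Laplace asymptotics evaluate at scale `β ^ (-1/2)`. In the mean
displacement the reflection across the line through `q` removes the first tangential order, leaving
at order `β⁻¹` the spherical gradient of the density and the curvature term `-(d - 1) / 2 • q`. The
centred numerator satisfies a triangular-array central limit theorem, the denominator a weak law of
large numbers, and Slutsky's theorem combines the two.
-/

/-! ### Gaussian integrals -/

section GaussianIntegrals

variable {E : Type*} [NormedAddCommGroup E] [InnerProductSpace ℝ E] [FiniteDimensional ℝ E]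
  [MeasurableSpace E] [BorelSpace E]

theorem integrable_exp_neg_mul_norm_sq {b : ℝ} (hb : 0 < b) :
    Integrable fun v : E => Real.exp (-b * ‖v‖ ^ 2) := by
  have h := (GaussianFourier.integrable_cexp_neg_mul_sq_norm_add (V := E) (b := b)
    (by simpa using hb) 0 0).norm
  refine h.congr (ae_of_all _ fun v => ?_)
  simp [Complex.norm_exp, ← Complex.ofReal_pow, ← Complex.ofReal_neg, ← Complex.ofReal_mul]

theorem integral_exp_neg_norm_sq_div_two_mul_cexp_inner (t : E) :
    ∫ v : E, (Real.exp (-‖v‖ ^ 2 / 2) : ℂ) * Complex.exp (⟪v, t⟫ * Complex.I) =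
      ((√(2 * Real.pi) ^ Module.finrank ℝ E : ℝ) : ℂ) * Complex.exp (-‖t‖ ^ 2 / 2) := by
  have hconst : ((Real.pi : ℂ) / (1 / 2)) ^ ((Module.finrank ℝ E : ℂ) / 2) =
      ((√(2 * Real.pi) ^ Module.finrank ℝ E : ℝ) : ℂ) := by
    rw [Real.sqrt_eq_rpow, ← Real.rpow_natCast, ← Real.rpow_mul (by positivity),
      Complex.ofReal_cpow (by positivity)]
    push_cast
    congr 1 <;> ring
  have key := GaussianFourier.integral_cexp_neg_mul_sq_norm_add (V := E) (b := (1 / 2 : ℂ))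
    (by norm_num) Complex.I t
  rw [hconst, Complex.I_sq] at key
  convert key using 2
  · ext v
    rw [Complex.ofReal_exp, ← Complex.exp_add, real_inner_comm]
    congr 1
    push_cast
    ring
  · congr 1
    ring

theorem withDensity_exp_neg_norm_sq_div_two :
    (volume : Measure E).withDensity (fun u => ENNReal.ofReal
      ((√(2 * Real.pi) ^ Module.finrank ℝ E)⁻¹ * Real.exp (-‖u‖ ^ 2 / 2))) = stdGaussian E := by
  have hc : 0 < √(2 * Real.pi) ^ Module.finrank ℝ E := by positivity
  have hint : Integrable fun u : E =>
      (√(2 * Real.pi) ^ Module.finrank ℝ E)⁻¹ * Real.exp (-‖u‖ ^ 2 / 2) :=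
    ((integrable_exp_neg_mul_norm_sq (E := E) (b := 1 / 2) (by norm_num)).const_mul _).congr
      (ae_of_all _ fun v => by simp only; congr 2; ring)
  have := isFiniteMeasure_withDensity_ofReal hint.2
  refine Measure.ext_of_charFun (funext fun t => ?_)
  rw [charFun_stdGaussian, charFun_apply,
    integral_withDensity_eq_integral_toReal_smul (by fun_prop) (ae_of_all _ fun _ => by simp)]
  simp_rw [ENNReal.toReal_ofReal (mul_nonneg (inv_nonneg.2 hc.le) (Real.exp_pos _).le),
    mul_smul, integral_smul, Complex.real_smul, integral_exp_neg_norm_sq_div_two_mul_cexp_inner]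
  rw [← mul_assoc, ← Complex.ofReal_mul, inv_mul_cancel₀ hc.ne', Complex.ofReal_one, one_mul]

theorem integral_mul_exp_neg_norm_sq_div_two (f : E → ℝ) :
    ∫ u, f u * Real.exp (-‖u‖ ^ 2 / 2) =
      √(2 * Real.pi) ^ Module.finrank ℝ E * ∫ u, f u ∂stdGaussian E := by
  rw [← withDensity_exp_neg_norm_sq_div_two,
    integral_withDensity_eq_integral_toReal_smul (by fun_prop) (ae_of_all _ fun _ => by simp),
    ← integral_const_mul]
  refine integral_congr_ae (ae_of_all _ fun u => ?_)
  simp only [smul_eq_mul]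
  rw [ENNReal.toReal_ofReal (by positivity)]
  field_simp

theorem integrable_inner_mul_inner_stdGaussian (a b : E) :
    Integrable (fun u => ⟪a, u⟫ * ⟪b, u⟫) (stdGaussian E) :=
  (IsGaussian.memLp_two_id.const_inner a).integrable_mul (IsGaussian.memLp_two_id.const_inner b)

theorem integral_inner_mul_inner_stdGaussian (a b : E) :
    ∫ u, ⟪a, u⟫ * ⟪b, u⟫ ∂stdGaussian E = ⟪a, b⟫ := by
  have h := DFunLike.congr_fun (DFunLike.congr_fun (covarianceBilin_stdGaussian (E := E)) a) b
  rw [covarianceBilin_apply IsGaussian.memLp_two_id, innerSL_apply_apply] at h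
  simpa using h

theorem integrable_norm_sq_stdGaussian : Integrable (fun u => ‖u‖ ^ 2) (stdGaussian E) :=
  IsGaussian.memLp_two_id.integrable_norm_pow two_ne_zero

theorem integral_norm_sq_stdGaussian :
    ∫ u, ‖u‖ ^ 2 ∂stdGaussian E = Module.finrank ℝ E := by
  simp_rw [← (stdOrthonormalBasis ℝ E).sum_sq_inner_right, sq]
  rw [integral_finsetSum _ fun i _ => integrable_inner_mul_inner_stdGaussian _ _]
  simp [integral_inner_mul_inner_stdGaussian]

theorem integral_comp_add_inv_smul {F : Type*} [NormedAddCommGroup F] [NormedSpace ℝ F]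
    (f : E → F) (q : E) {s : ℝ} (hs : 0 < s) :
    ∫ u, f (q + s⁻¹ • u) = s ^ Module.finrank ℝ E • ∫ y, f y := by
  rw [Measure.integral_comp_smul volume (fun u => f (q + u)) s⁻¹, integral_add_left_eq_self,
    inv_pow, inv_inv, abs_of_pos (by positivity)]

end GaussianIntegrals

section RadialLaplace

theorem one_add_inv_mul_pow_mul_exp_le (m : ℕ) {s v : ℝ} (hs : 1 ≤ s) (hv : 0 < 1 + s⁻¹ * v) :
    (1 + s⁻¹ * v) ^ m * Real.exp (-v ^ 2 / 2) ≤
      Real.exp (m ^ 2) * Real.exp (-(1 / 4) * v ^ 2) := by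
  have hle : 1 + s⁻¹ * v ≤ Real.exp |v| := by
    have hsv : s⁻¹ * v ≤ |v| := by
      calc s⁻¹ * v ≤ s⁻¹ * |v| := by gcongr; exact le_abs_self v
        _ ≤ |v| := mul_le_of_le_one_left (abs_nonneg v) (inv_le_one_of_one_le₀ hs)
    linarith [Real.add_one_le_exp |v|]
  calc (1 + s⁻¹ * v) ^ m * Real.exp (-v ^ 2 / 2)
      ≤ Real.exp |v| ^ m * Real.exp (-v ^ 2 / 2) := by gcongr
    _ = Real.exp (m * |v| + -v ^ 2 / 2) := by rw [← Real.exp_nat_mul, Real.exp_add]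
    _ ≤ Real.exp (m ^ 2 + -(1 / 4) * v ^ 2) := by
        refine Real.exp_le_exp.mpr ?_
        nlinarith [sq_nonneg ((m : ℝ) - |v| / 2), sq_abs v]
    _ = _ := Real.exp_add _ _

theorem tendsto_one_add_inv_mul_atTop (v : ℝ) :
    Tendsto (fun s : ℝ => 1 + s⁻¹ * v) atTop (𝓝 1) := by
  simpa using (tendsto_inv_atTop_zero.mul_const v).const_add 1

theorem tendsto_mul_integral_pow_mul_exp (m : ℕ) :
    Tendsto (fun s : ℝ => s * ∫ r in Set.Ioi (0 : ℝ), r ^ m * Real.exp (-(s * (r - 1)) ^ 2 / 2))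
      atTop (𝓝 √(2 * Real.pi)) := by
  set f : ℝ → ℝ → ℝ := fun s =>
    (Set.Ioi (0 : ℝ)).indicator fun r => r ^ m * Real.exp (-(s * (r - 1)) ^ 2 / 2)
  have hf {s v : ℝ} (hs : 0 < s) (hv : 0 < 1 + s⁻¹ * v) :
      f s (1 + s⁻¹ * v) = (1 + s⁻¹ * v) ^ m * Real.exp (-v ^ 2 / 2) := by
    simp only [f]
    rw [Set.indicator_of_mem (Set.mem_Ioi.2 hv), add_sub_cancel_left, mul_inv_cancel_left₀ hs.ne']
  have hlim : ∫ v : ℝ, Real.exp (-v ^ 2 / 2) = √(2 * Real.pi) := by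
    simpa using integral_mul_exp_neg_norm_sq_div_two (E := ℝ) fun _ => 1
  rw [← hlim]
  have hrescale : ∀ᶠ s : ℝ in atTop, ∫ v, f s (1 + s⁻¹ * v) =
      s * ∫ r in Set.Ioi (0 : ℝ), r ^ m * Real.exp (-(s * (r - 1)) ^ 2 / 2) := by
    filter_upwards [eventually_gt_atTop 0] with s hs
    simpa [integral_indicator measurableSet_Ioi, f] using
      integral_comp_add_inv_smul (f s) 1 hs
  refine (tendsto_integral_filter_of_dominated_convergence
    (fun v => Real.exp (m ^ 2) * Real.exp (-(1 / 4) * v ^ 2)) ?_ ?_ ?_ ?_).congr' hrescale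
  · refine Eventually.of_forall fun s => Measurable.aestronglyMeasurable ?_
    exact (Measurable.indicator (by fun_prop) measurableSet_Ioi).comp (by fun_prop)
  · filter_upwards [eventually_ge_atTop 1] with s hs
    refine ae_of_all _ fun v => ?_
    by_cases hv : 0 < 1 + s⁻¹ * v
    · rw [hf (by linarith) hv, Real.norm_of_nonneg (by positivity)]
      exact one_add_inv_mul_pow_mul_exp_le m hs hv
    · simp only [f]
      rw [Set.indicator_of_notMem (mt Set.mem_Ioi.1 hv), norm_zero]
      positivity
  · exact (integrable_exp_neg_mul_sq (by norm_num)).const_mul _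
  · refine ae_of_all _ fun v => ?_
    have hone := tendsto_one_add_inv_mul_atTop v
    have h : Tendsto (fun s : ℝ => (1 + s⁻¹ * v) ^ m * Real.exp (-v ^ 2 / 2)) atTop
        (𝓝 (Real.exp (-v ^ 2 / 2))) := by
      simpa using (hone.pow m).mul_const (Real.exp (-v ^ 2 / 2))
    refine h.congr' ?_
    filter_upwards [hone.eventually (lt_mem_nhds one_pos), eventually_gt_atTop 0] with s hv hs
    exact (hf hs hv).symm

end RadialLaplace

/-! ### Normalization of vectors near a unit vector -/

section Normalize

variable {E : Type*} [NormedAddCommGroup E]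

theorem norm_normalize_sub_self [NormedSpace ℝ E] {y : E} (hy : y ≠ 0) :
    ‖normalize y - y‖ = |‖y‖ - 1| := by
  have h : normalize y - y = (1 - ‖y‖) • normalize y := by
    rw [sub_smul, one_smul, NormedSpace.norm_smul_normalize]
  rw [h, norm_smul, NormedSpace.norm_normalize hy, mul_one, Real.norm_eq_abs, abs_sub_comm]

theorem norm_normalize_sub_le [NormedSpace ℝ E] {q y : E} (hq : ‖q‖ = 1) (hy : y ≠ 0) :
    ‖normalize y - q‖ ≤ 2 * ‖y - q‖ := by
  have h : |‖y‖ - 1| ≤ ‖y - q‖ := hq ▸ abs_norm_sub_norm_le y q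
  calc ‖normalize y - q‖ ≤ ‖normalize y - y‖ + ‖y - q‖ := norm_sub_le_norm_sub_add_norm_sub _ _ _
    _ ≤ 2 * ‖y - q‖ := by rw [norm_normalize_sub_self hy]; linarith

theorem norm_sub_sq_le_normalize [NormedSpace ℝ E] (q : E) {y : E} (hy : y ≠ 0) :
    ‖y - q‖ ^ 2 ≤ 2 * (‖normalize y - q‖ ^ 2 + (‖y‖ - 1) ^ 2) := by
  have h : ‖y - q‖ ≤ |‖y‖ - 1| + ‖normalize y - q‖ := by
    rw [← norm_normalize_sub_self hy, norm_sub_rev (normalize y) y]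
    exact norm_sub_le_norm_sub_add_norm_sub _ _ _
  calc ‖y - q‖ ^ 2 ≤ (|‖y‖ - 1| + ‖normalize y - q‖) ^ 2 := by gcongr
    _ ≤ 2 * (|‖y‖ - 1| ^ 2 + ‖normalize y - q‖ ^ 2) := add_sq_le
    _ = _ := by rw [sq_abs, add_comm]

variable [InnerProductSpace ℝ E] {q : E}

theorem norm_sub_inner_smul_sq (hq : ‖q‖ = 1) (u : E) :
    ‖u - ⟪q, u⟫ • q‖ ^ 2 = ‖u‖ ^ 2 - ⟪q, u⟫ ^ 2 := by
  rw [norm_sub_sq_real, norm_smul, hq, real_inner_smul_right, real_inner_comm,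
    Real.norm_eq_abs, mul_one, sq_abs]
  ring

theorem hasFDerivAt_norm_of_norm_eq_one (hq : ‖q‖ = 1) :
    HasFDerivAt (fun y : E => ‖y‖) (innerSL ℝ q) q := by
  have h := (hasStrictFDerivAt_norm_sq q).hasFDerivAt.sqrt (by simp [hq])
  simp only [Real.sqrt_sq (norm_nonneg _)] at h
  exact h.congr_fderiv (by ext u; simp [hq])

theorem hasFDerivAt_normalize_of_norm_eq_one (hq : ‖q‖ = 1) :
    HasFDerivAt (normalize : E → E)
      (ContinuousLinearMap.id ℝ E - (innerSL ℝ q).smulRight q) q := by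
  have hinv := (hasDerivAt_inv (by simp [hq] : ‖q‖ ≠ 0)).comp_hasFDerivAt q
    (hasFDerivAt_norm_of_norm_eq_one hq)
  refine (hinv.smul (hasFDerivAt_id q)).congr_fderiv ?_
  ext u
  simp [hq, sub_eq_add_neg]

theorem tendsto_mul_norm_add_inv_smul_sub_one (hq : ‖q‖ = 1) (u : E) :
    Tendsto (fun s : ℝ => s * (‖q + s⁻¹ • u‖ - 1)) atTop (𝓝 ⟪q, u⟫) := by
  simpa [hq] using (hasFDerivAt_norm_of_norm_eq_one hq).lim_real u

theorem tendsto_smul_normalize_add_inv_smul_sub (hq : ‖q‖ = 1) (u : E) :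
    Tendsto (fun s : ℝ => s • (normalize (q + s⁻¹ • u) - q)) atTop (𝓝 (u - ⟪q, u⟫ • q)) := by
  simpa [NormedSpace.normalize_eq_self_of_norm_eq_one hq] using
    (hasFDerivAt_normalize_of_norm_eq_one hq).lim_real u

end Normalize

theorem tendsto_add_inv_smul_atTop {E : Type*} [NormedAddCommGroup E] [NormedSpace ℝ E]
    (q u : E) : Tendsto (fun s : ℝ => q + s⁻¹ • u) atTop (𝓝 q) := by
  simpa using ((tendsto_inv_atTop_zero (𝕜 := ℝ)).smul_const u).const_add q

/-! ### The sphere in polar coordinates -/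

section RadialExtension

variable {d : ℕ}

/-- The radial projection of `ℝ^d ∖ {0}` onto the unit sphere. -/
noncomputable def radialProj (y : Euc d) (hy : y ≠ 0) : USphere d :=
  ⟨normalize y, by simpa using hy⟩

@[simp]
theorem coe_radialProj {y : Euc d} (hy : y ≠ 0) : (radialProj y hy : Euc d) = normalize y := rfl

theorem radialExtension_of_ne_zero (f : USphere d → ℝ) {y : Euc d} (hy : y ≠ 0) :
    radialExtension f y = f (radialProj y hy) :=
  dif_neg hy

@[simp]
theorem radialExtension_zero (f : USphere d → ℝ) : radialExtension f 0 = 0 :=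
  dif_pos rfl

theorem radialExtension_coe (f : USphere d → ℝ) (x : USphere d) : radialExtension f x = f x := by
  rw [radialExtension_of_ne_zero f (ne_zero_of_mem_unit_sphere x)]
  congr 1
  ext1
  exact NormedSpace.normalize_eq_self_of_norm_eq_one (norm_eq_of_mem_sphere x)

theorem radialExtension_smul_coe (f : USphere d → ℝ) (x : USphere d) {r : ℝ} (hr : 0 < r) :
    radialExtension f (r • (x : Euc d)) = f x := by
  have hx : (x : Euc d) ≠ 0 := ne_zero_of_mem_unit_sphere x
  rw [← radialExtension_coe f x, radialExtension_of_ne_zero f hx,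
    radialExtension_of_ne_zero f (smul_ne_zero hr.ne' hx)]
  congr 1
  ext1
  exact NormedSpace.normalize_smul_of_pos hr _

theorem measurable_radialExtension {f : USphere d → ℝ} (hf : Measurable f) :
    Measurable (radialExtension f) := by
  refine measurable_of_measurable_on_compl_singleton 0 ?_
  have h : Measurable fun y : {y : Euc d | y ≠ 0} => f (radialProj y y.2) :=
    hf.comp (Measurable.subtype_mk (by unfold NormedSpace.normalize; fun_prop))
  convert h using 1
  ext y
  exact radialExtension_of_ne_zero f y.2

end RadialExtension

section SurfaceMeasure

instance {d : ℕ} : IsFiniteMeasure (surfaceMeasure d) :=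
  inferInstanceAs (IsFiniteMeasure (volume : Measure (Euc d)).toSphere)

theorem integral_volumeIoiPow (m : ℕ) (g : ℝ → ℝ) :
    ∫ r : Set.Ioi (0 : ℝ), g r ∂Measure.volumeIoiPow m = ∫ r in Set.Ioi (0 : ℝ), r ^ m * g r := by
  simp only [Measure.volumeIoiPow, ENNReal.ofReal]
  rw [integral_withDensity_eq_integral_smul (measurable_subtype_coe.pow_const _).real_toNNReal,
    integral_subtype_comap measurableSet_Ioi fun r => Real.toNNReal (r ^ m) • g r]
  refine setIntegral_congr_fun measurableSet_Ioi fun r hr => ?_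
  rw [NNReal.smul_def, Real.coe_toNNReal _ (pow_nonneg hr.out.le _), smul_eq_mul]

theorem integral_norm_mul_radialExtension {m : ℕ} (f : USphere (m + 1) → ℝ) (g : ℝ → ℝ) :
    ∫ y : Euc (m + 1), g ‖y‖ * radialExtension f y =
      (∫ x, f x ∂surfaceMeasure (m + 1)) * ∫ r in Set.Ioi (0 : ℝ), r ^ m * g r := by
  have hpolar :=
    (volume : Measure (Euc (m + 1))).measurePreserving_homeomorphUnitSphereProd.integral_comp
      (Homeomorph.measurableEmbedding _)
      fun z : USphere (m + 1) × Set.Ioi (0 : ℝ) => f z.1 * g z.2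
  rw [finrank_euclideanSpace_fin, Nat.add_sub_cancel] at hpolar
  calc ∫ y : Euc (m + 1), g ‖y‖ * radialExtension f y
      = ∫ y : ({0}ᶜ : Set (Euc (m + 1))), g ‖y.1‖ * radialExtension f y.1
          ∂((volume : Measure (Euc (m + 1))).comap (↑)) := by
        rw [integral_subtype_comap (measurableSet_singleton _).compl
          fun y => g ‖y‖ * radialExtension f y, restrict_compl_singleton]
    _ = ∫ z : USphere (m + 1) × Set.Ioi (0 : ℝ), f z.1 * g z.2
          ∂((surfaceMeasure (m + 1)).prod (.volumeIoiPow m)) := by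
        rw [surfaceMeasure, ← hpolar]
        refine integral_congr_ae (ae_of_all _ fun y => ?_)
        have hproj : radialProj y.1 y.2 = (homeomorphUnitSphereProd (Euc (m + 1)) y).1 :=
          Subtype.ext (homeomorphUnitSphereProd_apply_fst_coe _ y).symm
        simp only [radialExtension_of_ne_zero f y.2, homeomorphUnitSphereProd_apply_snd_coe]
        rw [mul_comm, hproj]
    _ = (∫ x, f x ∂surfaceMeasure (m + 1)) *
          ∫ r : Set.Ioi (0 : ℝ), g r ∂(Measure.volumeIoiPow m) :=
        integral_prod_mul f fun r : Set.Ioi (0 : ℝ) => g r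
    _ = _ := by rw [integral_volumeIoiPow]

variable {d : ℕ}

/-- The action of a linear isometry of `ℝ^d` on the unit sphere. -/
noncomputable def sphereIsometry (R : Euc d ≃ₗᵢ[ℝ] Euc d) : USphere d ≃ₜ USphere d :=
  R.toHomeomorph.subtype fun y => by simp

@[simp]
theorem coe_sphereIsometry (R : Euc d ≃ₗᵢ[ℝ] Euc d) (x : USphere d) :
    (sphereIsometry R x : Euc d) = R x := rfl

open scoped Pointwise in
theorem measurePreserving_sphereIsometry (R : Euc d ≃ₗᵢ[ℝ] Euc d) :
    MeasurePreserving (sphereIsometry R) (surfaceMeasure d) (surfaceMeasure d) := by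
  have hR := (sphereIsometry R).continuous.measurable
  have hcone (s : Set (USphere d)) :
      R.toMeasurableEquiv ⁻¹' (Set.Ioo (0 : ℝ) 1 • ((↑) '' s : Set (Euc d))) =
        Set.Ioo (0 : ℝ) 1 • ((↑) '' (sphereIsometry R ⁻¹' s) : Set (Euc d)) := by
    ext y
    simp only [Set.mem_smul, Set.mem_image, Set.mem_preimage]
    constructor
    · rintro ⟨r, hr, _, ⟨x, hx, rfl⟩, h⟩
      refine ⟨r, hr, _, ⟨(sphereIsometry R).symm x, by simpa using hx, rfl⟩, R.injective ?_⟩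
      rw [map_smul, ← coe_sphereIsometry, Homeomorph.apply_symm_apply]
      exact h
    · rintro ⟨r, hr, _, ⟨x, hx, rfl⟩, rfl⟩
      exact ⟨r, hr, _, ⟨sphereIsometry R x, hx, rfl⟩, (map_smul R r _).symm⟩
  refine ⟨hR, Measure.ext fun s hs => ?_⟩
  rw [Measure.map_apply hR hs, surfaceMeasure, Measure.toSphere_apply' _ hs,
    Measure.toSphere_apply' _ (hR hs), ← hcone]
  congr 1
  exact R.measurePreserving.measure_preimage_equiv (f := R.toMeasurableEquiv) _

/-- The reflection of the sphere across the line through `q` reverses tangential components. -/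
theorem integral_mul_inner_tangential_eq_zero (q : USphere d) (t : Euc d) (φ : ℝ → ℝ) :
    ∫ x, φ ⟪(q : Euc d), x⟫ * ⟪t, (x : Euc d) - ⟪(q : Euc d), x⟫ • (q : Euc d)⟫
      ∂surfaceMeasure d = 0 := by
  have hq : ‖(q : Euc d)‖ = 1 := norm_eq_of_mem_sphere q
  set R := (ℝ ∙ (q : Euc d)).reflection
  have hR (y : Euc d) : R y = (2 * ⟪(q : Euc d), y⟫) • (q : Euc d) - y := by
    rw [Submodule.reflection_apply, Submodule.starProjection_unit_singleton ℝ hq, two_smul,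
      two_mul, add_smul]
  have hqR (y : Euc d) : ⟪(q : Euc d), R y⟫ = ⟪(q : Euc d), y⟫ := by
    rw [hR, inner_sub_right, real_inner_smul_right, real_inner_self_eq_norm_sq, hq]
    ring
  have hodd (y : Euc d) : ⟪t, R y - ⟪(q : Euc d), R y⟫ • (q : Euc d)⟫ =
      -⟪t, y - ⟪(q : Euc d), y⟫ • (q : Euc d)⟫ := by
    rw [hqR, hR, ← inner_neg_right]
    congr 1
    module
  have hflip := (measurePreserving_sphereIsometry R).integral_comp
    (sphereIsometry R).measurableEmbedding
    fun x => φ ⟪(q : Euc d), x⟫ * ⟪t, (x : Euc d) - ⟪(q : Euc d), x⟫ • (q : Euc d)⟫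
  simp only [coe_sphereIsometry, hodd] at hflip
  simp only [hqR, mul_neg, integral_neg] at hflip
  linarith

theorem norm_sub_sq_sphere (q x : USphere d) :
    ‖(x : Euc d) - q‖ ^ 2 = 2 * (1 - ⟪(q : Euc d), x⟫) := by
  rw [norm_sub_sq_real, norm_eq_of_mem_sphere, norm_eq_of_mem_sphere, real_inner_comm]
  ring

end SurfaceMeasure

section SphereWeight

variable {d : ℕ} (q : USphere d) (s : ℝ)

/-- The Gaussian weight of width `s⁻¹` on the sphere, centred at `q`: the softmax weight at inverse
temperature `s ^ 2`, up to a factor that does not depend on the key. -/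
noncomputable def sphereWeight (x : USphere d) : ℝ :=
  Real.exp (-(s * ‖(x : Euc d) - q‖) ^ 2 / 2)

theorem sphereWeight_pos (x : USphere d) : 0 < sphereWeight q s x := Real.exp_pos _

theorem sphereWeight_le_one (x : USphere d) : sphereWeight q s x ≤ 1 :=
  Real.exp_le_one_iff.mpr (by linarith [sq_nonneg (s * ‖(x : Euc d) - q‖)])

@[fun_prop]
theorem continuous_sphereWeight : Continuous (sphereWeight q s) := by
  unfold sphereWeight
  fun_prop

theorem sphereWeight_eq_exp_inner (x : USphere d) :
    sphereWeight q s x = Real.exp (s ^ 2 * ⟪(q : Euc d), x⟫ - s ^ 2) := by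
  rw [sphereWeight, mul_pow, norm_sub_sq_sphere]
  congr 1
  ring

theorem sphereWeight_sq (x : USphere d) : sphereWeight q s x ^ 2 = sphereWeight q (√2 * s) x := by
  rw [sphereWeight, sphereWeight, ← Real.exp_nat_mul, mul_assoc, mul_pow (√2),
    Real.sq_sqrt two_pos.le]
  congr 1
  push_cast
  ring

theorem integral_sphereWeight_mul_inner_sub (t : Euc d) :
    ∫ x, sphereWeight q s x * ⟪t, (x : Euc d) - q⟫ ∂surfaceMeasure d =
      -(⟪t, (q : Euc d)⟫ / 2) *
        ∫ x, sphereWeight q s x * ‖(x : Euc d) - q‖ ^ 2 ∂surfaceMeasure d := by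
  have hint {f : USphere d → ℝ} (hf : Continuous f) : Integrable f (surfaceMeasure d) :=
    hf.integrable_of_hasCompactSupport (HasCompactSupport.of_compactSpace f)
  have htan := integral_mul_inner_tangential_eq_zero q t fun c => Real.exp (s ^ 2 * c - s ^ 2)
  simp only [← sphereWeight_eq_exp_inner] at htan
  rw [← integral_const_mul, ← sub_eq_zero, ← htan, ← integral_sub (hint (by fun_prop))
    (hint (by fun_prop))]
  congr 1 with x
  rw [norm_sub_sq_sphere, inner_sub_right, inner_sub_right, real_inner_smul_right]
  ring

end SphereWeight

/-! ### The Laplace method on the sphere -/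

section Laplace

variable {d : ℕ} (q : USphere d) (s : ℝ)

/-- The weight `sphereWeight q s`, extended along rays and damped by a Gaussian factor in the radial
direction; it is close to a full Gaussian of width `s⁻¹` centred at `q`. -/
noncomputable def polarGaussian (y : Euc d) : ℝ :=
  Real.exp (-(s * (‖y‖ - 1)) ^ 2 / 2) * radialExtension (sphereWeight q s) y

theorem measurable_polarGaussian : Measurable (polarGaussian q s) :=
  Measurable.mul (by fun_prop) (measurable_radialExtension (continuous_sphereWeight q s).measurable)

theorem polarGaussian_of_ne_zero {y : Euc d} (hy : y ≠ 0) :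
    polarGaussian q s y =
      Real.exp (-((s * (‖y‖ - 1)) ^ 2 + (s * ‖normalize y - q‖) ^ 2) / 2) := by
  rw [polarGaussian, radialExtension_of_ne_zero _ hy, sphereWeight, coe_radialProj, ← Real.exp_add]
  congr 1
  ring

theorem polarGaussian_nonneg (y : Euc d) : 0 ≤ polarGaussian q s y := by
  by_cases hy : y = 0
  · simp [polarGaussian, hy]
  · rw [polarGaussian_of_ne_zero q s hy]
    positivity

theorem integral_polarGaussian_mul_radialExtension {m : ℕ} (q : USphere (m + 1)) (s : ℝ)
    (f : USphere (m + 1) → ℝ) :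
    ∫ y, polarGaussian q s y * radialExtension f y =
      (∫ x, sphereWeight q s x * f x ∂surfaceMeasure (m + 1)) *
        ∫ r in Set.Ioi (0 : ℝ), r ^ m * Real.exp (-(s * (r - 1)) ^ 2 / 2) := by
  rw [← integral_norm_mul_radialExtension (fun x => sphereWeight q s x * f x) fun r =>
    Real.exp (-(s * (r - 1)) ^ 2 / 2)]
  congr 1 with y
  by_cases hy : y = 0
  · simp [hy]
  · simp only [polarGaussian, radialExtension_of_ne_zero _ hy, mul_assoc]

theorem norm_coe_add_inv_smul_sub {s : ℝ} (hs : 0 < s) (u : Euc d) :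
    ‖(q : Euc d) + s⁻¹ • u - q‖ = s⁻¹ * ‖u‖ := by
  rw [add_sub_cancel_left, norm_smul, Real.norm_of_nonneg (by positivity)]

theorem polarGaussian_le {s : ℝ} (hs : 0 < s) (u : Euc d) :
    polarGaussian q s ((q : Euc d) + s⁻¹ • u) ≤ Real.exp (-‖u‖ ^ 2 / 4) := by
  set y := (q : Euc d) + s⁻¹ • u with hy
  by_cases hy0 : y = 0
  · rw [hy0, polarGaussian, radialExtension_zero, mul_zero]
    positivity
  have hu : ‖u‖ ^ 2 ≤ 2 * ((s * ‖normalize y - q‖) ^ 2 + (s * (‖y‖ - 1)) ^ 2) := by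
    calc ‖u‖ ^ 2 = s ^ 2 * ‖y - q‖ ^ 2 := by
          rw [hy, norm_coe_add_inv_smul_sub q hs, mul_pow, ← mul_assoc, ← mul_pow,
            mul_inv_cancel₀ hs.ne', one_pow, one_mul]
      _ ≤ s ^ 2 * (2 * (‖normalize y - q‖ ^ 2 + (‖y‖ - 1) ^ 2)) := by
          gcongr
          exact norm_sub_sq_le_normalize _ hy0
      _ = _ := by ring
  rw [polarGaussian_of_ne_zero q s hy0]
  exact Real.exp_le_exp.2 (by linarith)

theorem abs_radialExtension_le {s C : ℝ} (hs : 0 < s) {f : USphere d → ℝ}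
    (hf : ∀ x, |f x| ≤ C * (1 + (s * ‖(x : Euc d) - q‖) ^ 2)) (u : Euc d) :
    |radialExtension f ((q : Euc d) + s⁻¹ • u)| ≤ 32 * C * Real.exp (‖u‖ ^ 2 / 8) := by
  have hC : 0 ≤ C := by simpa using (abs_nonneg _).trans (hf q)
  set y := (q : Euc d) + s⁻¹ • u with hy
  by_cases hy0 : y = 0
  · rw [hy0, radialExtension_zero, abs_zero]
    positivity
  have hdist : s * ‖normalize y - q‖ ≤ 2 * ‖u‖ := by
    calc s * ‖normalize y - q‖ ≤ s * (2 * ‖y - q‖) := by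
          gcongr
          exact norm_normalize_sub_le (norm_eq_of_mem_sphere q) hy0
      _ = 2 * ‖u‖ := by
          rw [hy, norm_coe_add_inv_smul_sub q hs]
          field_simp
  calc |radialExtension f y| ≤ C * (1 + (s * ‖normalize y - q‖) ^ 2) := by
        rw [radialExtension_of_ne_zero f hy0]
        exact hf _
    _ ≤ C * (1 + (2 * ‖u‖) ^ 2) := by gcongr
    _ ≤ C * (32 * (‖u‖ ^ 2 / 8 + 1)) := by
        gcongr
        linarith
    _ ≤ C * (32 * Real.exp (‖u‖ ^ 2 / 8)) := by
        gcongr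
        exact Real.add_one_le_exp _
    _ = _ := by ring

theorem eventually_coe_add_inv_smul_ne_zero (u : Euc d) :
    ∀ᶠ s : ℝ in atTop, (q : Euc d) + s⁻¹ • u ≠ 0 :=
  (tendsto_add_inv_smul_atTop (q : Euc d) u).eventually_ne (ne_zero_of_mem_unit_sphere q)

theorem tendsto_mul_norm_normalize_sub (u : Euc d) :
    Tendsto (fun s : ℝ => s * ‖normalize ((q : Euc d) + s⁻¹ • u) - q‖) atTop
      (𝓝 ‖u - ⟪(q : Euc d), u⟫ • (q : Euc d)‖) := by
  refine (tendsto_smul_normalize_add_inv_smul_sub (norm_eq_of_mem_sphere q) u).norm.congr' ?_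
  filter_upwards [eventually_ge_atTop 0] with s hs
  rw [norm_smul, Real.norm_of_nonneg hs]

theorem tendsto_polarGaussian (u : Euc d) :
    Tendsto (fun s : ℝ => polarGaussian q s ((q : Euc d) + s⁻¹ • u)) atTop
      (𝓝 (Real.exp (-‖u‖ ^ 2 / 2))) := by
  have hq : ‖(q : Euc d)‖ = 1 := norm_eq_of_mem_sphere q
  have hexponent := (((tendsto_mul_norm_add_inv_smul_sub_one hq u).pow 2).add
    ((tendsto_mul_norm_normalize_sub q u).pow 2)).neg.div_const 2
  rw [norm_sub_inner_smul_sq hq, add_sub_cancel] at hexponent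
  refine ((Real.continuous_exp.tendsto _).comp hexponent).congr' ?_
  filter_upwards [eventually_coe_add_inv_smul_ne_zero q u] with s hy
  exact (polarGaussian_of_ne_zero q s hy).symm

theorem tendsto_integral_polarGaussian (h : ℝ → USphere d → ℝ) (H : Euc d → ℝ) (C : ℝ)
    (hmeas : ∀ s, Measurable (h s))
    (hbound : ∀ s x, |h s x| ≤ C * (1 + (s * ‖(x : Euc d) - q‖) ^ 2))
    (hlim : ∀ u, Tendsto (fun s : ℝ => radialExtension (h s) ((q : Euc d) + s⁻¹ • u)) atTop
      (𝓝 (H u))) :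
    Tendsto (fun s : ℝ => ∫ u, polarGaussian q s ((q : Euc d) + s⁻¹ • u) *
        radialExtension (h s) ((q : Euc d) + s⁻¹ • u)) atTop
      (𝓝 (√(2 * Real.pi) ^ d * ∫ u, H u ∂stdGaussian (Euc d))) := by
  have hgaussian := integral_mul_exp_neg_norm_sq_div_two H
  rw [finrank_euclideanSpace_fin] at hgaussian
  rw [← hgaussian]
  refine tendsto_integral_filter_of_dominated_convergence
    (fun u => 32 * C * Real.exp (-(1 / 8) * ‖u‖ ^ 2)) ?_ ?_
    ((integrable_exp_neg_mul_norm_sq (by norm_num)).const_mul _) ?_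
  · exact Eventually.of_forall fun s => (((measurable_polarGaussian q s).mul
      (measurable_radialExtension (hmeas s))).comp (by fun_prop)).aestronglyMeasurable
  · filter_upwards [eventually_gt_atTop 0] with s hs
    refine ae_of_all _ fun u => ?_
    rw [norm_mul, Real.norm_of_nonneg (polarGaussian_nonneg q s _)]
    calc _ ≤ Real.exp (-‖u‖ ^ 2 / 4) * (32 * C * Real.exp (‖u‖ ^ 2 / 8)) :=
          mul_le_mul (polarGaussian_le q hs u) (abs_radialExtension_le q hs (hbound s) u)
            (abs_nonneg _) (Real.exp_pos _).le
      _ = 32 * C * Real.exp (-‖u‖ ^ 2 / 4 + ‖u‖ ^ 2 / 8) := by rw [Real.exp_add]; ring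
      _ = _ := by ring_nf
  · refine ae_of_all _ fun u => ?_
    rw [mul_comm (H u)]
    exact (tendsto_polarGaussian q u).mul (hlim u)

theorem tendsto_pow_mul_integral_sphereWeight {m : ℕ} (q : USphere (m + 1))
    (h : ℝ → USphere (m + 1) → ℝ) (H : Euc (m + 1) → ℝ) (C : ℝ)
    (hmeas : ∀ s, Measurable (h s))
    (hbound : ∀ s x, |h s x| ≤ C * (1 + (s * ‖(x : Euc (m + 1)) - q‖) ^ 2))
    (hlim : ∀ u, Tendsto (fun s : ℝ => radialExtension (h s) ((q : Euc (m + 1)) + s⁻¹ • u)) atTop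
      (𝓝 (H u))) :
    Tendsto (fun s : ℝ => s ^ m * ∫ x, sphereWeight q s x * h s x ∂surfaceMeasure (m + 1)) atTop
      (𝓝 (√(2 * Real.pi) ^ m * ∫ u, H u ∂stdGaussian (Euc (m + 1)))) := by
  have hpi : √(2 * Real.pi) ≠ 0 := by positivity
  have hradial := tendsto_mul_integral_pow_mul_exp m
  have hquot := (tendsto_integral_polarGaussian q h H C hmeas hbound hlim).div hradial hpi
  rw [pow_succ, mul_right_comm, mul_div_cancel_right₀ _ hpi] at hquot
  refine hquot.congr' ?_
  filter_upwards [eventually_gt_atTop 0, hradial.eventually_ne hpi] with s hs hne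
  rw [Pi.div_apply, div_eq_iff hne,
    integral_comp_add_inv_smul (fun y => polarGaussian q s y * radialExtension (h s) y) _ hs,
    integral_polarGaussian_mul_radialExtension, finrank_euclideanSpace_fin, smul_eq_mul]
  ring

end Laplace

/-! ### Moments of the Gaussian weight under the key law -/

section Density

variable {d : ℕ}

/-- The regularity of the key density away from the query: `ρ` is the density of a finite measure
and is bounded, so that keys far from the query cannot contribute to the Laplace asymptotics. -/
structure IsBoundedDensity (ρ : USphere d → ℝ) : Prop where
  measurable : Measurable ρ
  nonneg : ∀ x, 0 ≤ ρ x
  bounded : ∃ M, ∀ x, ρ x ≤ M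

theorem IsBoundedDensity.exists_abs_le {ρ : USphere d → ℝ} (hρ : IsBoundedDensity ρ) :
    ∃ M, ∀ x, |ρ x| ≤ M :=
  hρ.bounded.imp fun _ hM x => (abs_of_nonneg (hρ.nonneg x)).trans_le (hM x)

theorem isBoundedDensity_of_continuous {ρ : USphere d → ℝ} (hcont : Continuous ρ)
    (hnonneg : ∀ x, 0 ≤ ρ x) : IsBoundedDensity ρ where
  measurable := hcont.measurable
  nonneg := hnonneg
  bounded := (isCompact_range hcont).bddAbove.imp fun _ hM x => hM (Set.mem_range_self x)

theorem integral_keyLaw {ρ : USphere d → ℝ} (hρ : IsBoundedDensity ρ) (f : USphere d → ℝ) :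
    ∫ x, f x ∂keyLaw ρ = ∫ x, f x * ρ x ∂surfaceMeasure d := by
  rw [keyLaw, integral_withDensity_eq_integral_toReal_smul hρ.measurable.ennreal_ofReal
    (ae_of_all _ fun _ => ENNReal.ofReal_lt_top)]
  refine integral_congr_ae (ae_of_all _ fun x => ?_)
  simp only [ENNReal.toReal_ofReal (hρ.nonneg x), smul_eq_mul, mul_comm]

theorem radialExtension_mul (f g : USphere d → ℝ) (y : Euc d) :
    radialExtension (fun x => f x * g x) y = radialExtension f y * radialExtension g y := by
  by_cases hy : y = 0
  · simp [hy]
  · simp only [radialExtension_of_ne_zero _ hy]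

theorem tendsto_radialExtension_mul_inner_sub (q : USphere d) (t u : Euc d) :
    Tendsto (fun s : ℝ => radialExtension (fun x => s * ⟪t, (x : Euc d) - q⟫)
      ((q : Euc d) + s⁻¹ • u)) atTop (𝓝 ⟪t - ⟪(q : Euc d), t⟫ • (q : Euc d), u⟫) := by
  have hproj : ⟪t, u - ⟪(q : Euc d), u⟫ • (q : Euc d)⟫ =
      ⟪t - ⟪(q : Euc d), t⟫ • (q : Euc d), u⟫ := by
    rw [inner_sub_right, inner_sub_left, real_inner_smul_right, real_inner_smul_left,
      real_inner_comm t]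
    ring
  rw [← hproj]
  refine ((tendsto_const_nhds (x := t)).inner (𝕜 := ℝ)
    (tendsto_smul_normalize_add_inv_smul_sub (norm_eq_of_mem_sphere q) u)).congr' ?_
  filter_upwards [eventually_coe_add_inv_smul_ne_zero q u] with s hy
  rw [radialExtension_of_ne_zero _ hy, coe_radialProj, real_inner_smul_right]

theorem tendsto_radialExtension_mul_norm_sub_sq (q : USphere d) (u : Euc d) :
    Tendsto (fun s : ℝ => radialExtension (fun x => (s * ‖(x : Euc d) - q‖) ^ 2)
      ((q : Euc d) + s⁻¹ • u)) atTop (𝓝 (‖u‖ ^ 2 - ⟪(q : Euc d), u⟫ ^ 2)) := by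
  rw [← norm_sub_inner_smul_sq (norm_eq_of_mem_sphere q)]
  refine ((tendsto_mul_norm_normalize_sub q u).pow 2).congr' ?_
  filter_upwards [eventually_coe_add_inv_smul_ne_zero q u] with s hy
  rw [radialExtension_of_ne_zero _ hy, coe_radialProj]

theorem abs_mul_inner_sub_le (q x : USphere d) (s : ℝ) (t : Euc d) :
    |s * ⟪t, (x : Euc d) - q⟫| ≤ ‖t‖ * |s * ‖(x : Euc d) - q‖| := by
  rw [abs_mul, abs_mul, abs_norm, mul_left_comm]
  gcongr
  exact abs_real_inner_le_norm t _

theorem sq_mul_inner_sub_le (q x : USphere d) (s : ℝ) (t : Euc d) :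
    (s * ⟪t, (x : Euc d) - q⟫) ^ 2 ≤ ‖t‖ ^ 2 * (s * ‖(x : Euc d) - q‖) ^ 2 := by
  rw [← mul_pow, ← sq_abs, ← sq_abs (‖t‖ * _), abs_mul ‖t‖, abs_norm]
  gcongr
  exact abs_mul_inner_sub_le q x s t

end Density

/-- The mean `∫ exp (-s² ‖x - q‖² / 2) ρ(x) dσ(x)` of the Gaussian weight of a random key: the
expected softmax normalization per key, up to the factor `exp (s²)`. -/
noncomputable def meanSphereWeight {d : ℕ} (ρ : USphere d → ℝ) (q : USphere d) (s : ℝ) : ℝ :=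
  ∫ x, sphereWeight q s x ∂keyLaw ρ

section EvenMoments

variable {m : ℕ} {ρ : USphere (m + 1) → ℝ} {q : USphere (m + 1)}

theorem tendsto_pow_mul_integral_keyLaw (hρ : IsBoundedDensity ρ)
    (hcont : ContinuousAt (radialExtension ρ) q) (h : ℝ → USphere (m + 1) → ℝ)
    (H : Euc (m + 1) → ℝ) (C : ℝ) (hmeas : ∀ s, Measurable (h s))
    (hbound : ∀ s x, |h s x| ≤ C * (1 + (s * ‖(x : Euc (m + 1)) - q‖) ^ 2))
    (hlim : ∀ u, Tendsto (fun s : ℝ => radialExtension (h s) ((q : Euc (m + 1)) + s⁻¹ • u)) atTop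
      (𝓝 (H u))) :
    Tendsto (fun s : ℝ => s ^ m * ∫ x, sphereWeight q s x * h s x ∂keyLaw ρ) atTop
      (𝓝 (√(2 * Real.pi) ^ m * ((∫ u, H u ∂stdGaussian (Euc (m + 1))) * ρ q))) := by
  obtain ⟨M, hM⟩ := hρ.exists_abs_le
  have hlaplace := tendsto_pow_mul_integral_sphereWeight q (fun s x => h s x * ρ x)
    (fun u => H u * ρ q) (C * M) (fun s => (hmeas s).mul hρ.measurable) ?_ ?_
  · simpa only [integral_keyLaw hρ, mul_assoc, integral_mul_const] using hlaplace
  · intro s x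
    rw [abs_mul, mul_right_comm]
    exact mul_le_mul (hbound s x) (hM x) (abs_nonneg _) ((abs_nonneg _).trans (hbound s x))
  · intro u
    simp only [radialExtension_mul]
    have hρu := hcont.tendsto.comp (tendsto_add_inv_smul_atTop (q : Euc (m + 1)) u)
    rw [radialExtension_coe] at hρu
    exact (hlim u).mul hρu

theorem tendsto_pow_mul_meanSphereWeight (hρ : IsBoundedDensity ρ)
    (hcont : ContinuousAt (radialExtension ρ) q) :
    Tendsto (fun s : ℝ => s ^ m * meanSphereWeight ρ q s) atTop
      (𝓝 (√(2 * Real.pi) ^ m * ρ q)) := by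
  have hlaplace := tendsto_pow_mul_integral_keyLaw hρ hcont (fun _ _ => 1) (fun _ => 1) 1
    (fun _ => measurable_const)
    (fun s x => by rw [abs_one, one_mul]; linarith [sq_nonneg (s * ‖(x : Euc (m + 1)) - q‖)]) ?_
  · simpa [meanSphereWeight] using hlaplace
  · intro u
    refine tendsto_const_nhds.congr' ?_
    filter_upwards [eventually_coe_add_inv_smul_ne_zero q u] with s hy
    rw [radialExtension_of_ne_zero _ hy]

theorem tendsto_pow_mul_integral_sphereWeight_mul_inner_sq_keyLaw (hρ : IsBoundedDensity ρ)
    (hcont : ContinuousAt (radialExtension ρ) q) (t : Euc (m + 1)) :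
    Tendsto (fun s : ℝ => s ^ m * (s ^ 2 * ∫ x, sphereWeight q s x *
        ⟪t, (x : Euc (m + 1)) - q⟫ ^ 2 ∂keyLaw ρ)) atTop
      (𝓝 (√(2 * Real.pi) ^ m * ((‖t‖ ^ 2 - ⟪(q : Euc (m + 1)), t⟫ ^ 2) * ρ q))) := by
  set p := t - ⟪(q : Euc (m + 1)), t⟫ • (q : Euc (m + 1)) with hp
  have hgaussian : ∫ u, ⟪p, u⟫ ^ 2 ∂stdGaussian (Euc (m + 1)) =
      ‖t‖ ^ 2 - ⟪(q : Euc (m + 1)), t⟫ ^ 2 := by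
    simp_rw [sq ⟪p, _⟫]
    rw [integral_inner_mul_inner_stdGaussian, real_inner_self_eq_norm_sq, hp,
      norm_sub_inner_smul_sq (norm_eq_of_mem_sphere q)]
  rw [← hgaussian]
  refine (tendsto_pow_mul_integral_keyLaw hρ hcont
    (fun s x => (s * ⟪t, (x : Euc (m + 1)) - q⟫) ^ 2) (fun u => ⟪p, u⟫ ^ 2) (‖t‖ ^ 2)
    (fun s => Continuous.measurable (by fun_prop)) (fun s x => ?_) fun u => ?_).congr fun s => ?_
  · rw [abs_of_nonneg (sq_nonneg _)]
    refine (sq_mul_inner_sub_le q x s t).trans ?_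
    gcongr
    linarith
  · refine ((tendsto_radialExtension_mul_inner_sub q t u).pow 2).congr' ?_
    filter_upwards [eventually_coe_add_inv_smul_ne_zero q u] with s hy
    simp only [radialExtension_of_ne_zero _ hy]
  · rw [← integral_const_mul (s ^ 2)]
    congr 2 with x
    ring

theorem tendsto_pow_mul_integral_sphereWeight_sq_mul_inner_sq_keyLaw (hρ : IsBoundedDensity ρ)
    (hcont : ContinuousAt (radialExtension ρ) q) (t : Euc (m + 1)) :
    Tendsto (fun s : ℝ => s ^ m * (s ^ 2 * ∫ x, sphereWeight q s x ^ 2 *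
        ⟪t, (x : Euc (m + 1)) - q⟫ ^ 2 ∂keyLaw ρ)) atTop
      (𝓝 (√(2 * Real.pi) ^ m * ((‖t‖ ^ 2 - ⟪(q : Euc (m + 1)), t⟫ ^ 2) * ρ q) /
        (√2 ^ m * 2))) := by
  have hscale : Tendsto (fun s : ℝ => √2 * s) atTop atTop :=
    tendsto_id.const_mul_atTop (by positivity)
  refine (((tendsto_pow_mul_integral_sphereWeight_mul_inner_sq_keyLaw hρ hcont t).comp
    hscale).div_const (√2 ^ m * 2)).congr fun s => ?_
  have h2 : √2 ^ m ≠ 0 := by positivity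
  simp only [Function.comp, sphereWeight_sq]
  rw [mul_pow √2 s 2, Real.sq_sqrt two_pos.le, mul_pow]
  field_simp

theorem eventually_meanSphereWeight_pos (hρ : IsBoundedDensity ρ)
    (hcont : ContinuousAt (radialExtension ρ) q) (hq : 0 < ρ q) :
    ∀ᶠ s in atTop, 0 < meanSphereWeight ρ q s := by
  filter_upwards [eventually_gt_atTop 0, (tendsto_pow_mul_meanSphereWeight hρ hcont).eventually
    (lt_mem_nhds (by positivity))] with s hs hmul
  exact pos_of_mul_pos_right hmul (by positivity)

end EvenMoments

section FirstMoment

variable {d : ℕ} {ρ : USphere d → ℝ} {q : USphere d}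

theorem tendsto_mul_radialExtension_sub (hdiff : DifferentiableAt ℝ (radialExtension ρ) q)
    (u : Euc d) :
    Tendsto (fun s : ℝ => s * (radialExtension ρ ((q : Euc d) + s⁻¹ • u) - ρ q)) atTop
      (𝓝 ⟪sphericalGradient ρ q, u⟫) := by
  have hlim := hdiff.hasGradientAt.hasFDerivAt.lim_real u
  rwa [radialExtension_coe, InnerProductSpace.toDual_apply_apply] at hlim

theorem inner_sphericalGradient_self (hdiff : DifferentiableAt ℝ (radialExtension ρ) q) :
    ⟪sphericalGradient ρ q, (q : Euc d)⟫ = 0 := by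
  refine tendsto_nhds_unique (tendsto_mul_radialExtension_sub hdiff (q : Euc d))
    (tendsto_const_nhds.congr' ?_)
  filter_upwards [eventually_gt_atTop 0] with s hs
  have hray : (q : Euc d) + s⁻¹ • (q : Euc d) = (1 + s⁻¹) • (q : Euc d) := by
    rw [add_smul, one_smul]
  rw [hray, radialExtension_smul_coe ρ q (by positivity), sub_self, mul_zero]

theorem sphericalGradient_log (hdiff : DifferentiableAt ℝ (radialExtension ρ) q) (hq : 0 < ρ q) :
    sphericalGradient (fun x => Real.log (ρ x)) q = (ρ q)⁻¹ • sphericalGradient ρ q := by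
  have hlog := hdiff.hasGradientAt.hasFDerivAt.log (by rw [radialExtension_coe]; exact hq.ne')
  rw [radialExtension_coe, ← map_smul] at hlog
  refine (hasGradientAt_iff_hasFDerivAt.2 (hlog.congr_of_eventuallyEq ?_)).gradient
  filter_upwards [isOpen_ne.mem_nhds (ne_zero_of_mem_unit_sphere q)] with y hy
  simp only [radialExtension_of_ne_zero _ hy]

theorem exists_abs_sub_le_mul_norm_sub {M : ℝ} (hM : ∀ x, |ρ x| ≤ M)
    (hdiff : DifferentiableAt ℝ (radialExtension ρ) q) :
    ∃ C, 0 ≤ C ∧ ∀ x : USphere d, |ρ x - ρ q| ≤ C * ‖(x : Euc d) - q‖ := by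
  obtain ⟨C, hC, hnear⟩ := hdiff.isBigO_sub.exists_nonneg
  obtain ⟨δ, hδ, hball⟩ := Metric.eventually_nhds_iff.mp hnear.bound
  have hM0 : 0 ≤ M := (abs_nonneg _).trans (hM q)
  refine ⟨C + 2 * M / δ, by positivity, fun x => ?_⟩
  rw [add_mul]
  by_cases hx : dist (x : Euc d) q < δ
  · have hlip := hball hx
    simp only [radialExtension_coe, Real.norm_eq_abs] at hlip
    exact hlip.trans (le_add_of_nonneg_right (by positivity))
  · rw [not_lt, dist_eq_norm] at hx
    calc |ρ x - ρ q| ≤ |ρ x| + |ρ q| := abs_sub _ _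
      _ ≤ 2 * M / δ * δ := by rw [div_mul_cancel₀ _ hδ.ne']; linarith [hM x, hM q]
      _ ≤ 2 * M / δ * ‖(x : Euc d) - q‖ := by gcongr
      _ ≤ _ := le_add_of_nonneg_left (by positivity)

end FirstMoment

section Drift

variable {m : ℕ} {ρ : USphere (m + 1) → ℝ} {q : USphere (m + 1)}

theorem tendsto_pow_mul_integral_sphereWeight_mul_inner_sub (q : USphere (m + 1))
    (t : Euc (m + 1)) :
    Tendsto (fun s : ℝ => s ^ m * (s ^ 2 * ∫ x, sphereWeight q s x * ⟪t, (x : Euc (m + 1)) - q⟫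
        ∂surfaceMeasure (m + 1))) atTop
      (𝓝 (-(⟪t, (q : Euc (m + 1))⟫ / 2) * (√(2 * Real.pi) ^ m * m))) := by
  have hgaussian : ∫ u, (‖u‖ ^ 2 - ⟪(q : Euc (m + 1)), u⟫ ^ 2) ∂stdGaussian (Euc (m + 1)) = m := by
    simp_rw [sq ⟪_, _⟫]
    rw [integral_sub integrable_norm_sq_stdGaussian (integrable_inner_mul_inner_stdGaussian _ _),
      integral_norm_sq_stdGaussian, integral_inner_mul_inner_stdGaussian,
      real_inner_self_eq_norm_sq, norm_eq_of_mem_sphere, finrank_euclideanSpace_fin]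
    push_cast
    ring
  have hlaplace := tendsto_pow_mul_integral_sphereWeight q
    (fun s x => (s * ‖(x : Euc (m + 1)) - q‖) ^ 2) _ 1
    (fun s => Continuous.measurable (by fun_prop))
    (fun s x => by rw [abs_of_nonneg (sq_nonneg _)]; linarith)
    (tendsto_radialExtension_mul_norm_sub_sq q)
  rw [hgaussian] at hlaplace
  refine (hlaplace.const_mul _).congr fun s => ?_
  rw [integral_sphereWeight_mul_inner_sub]
  simp only [mul_pow, mul_left_comm _ (s ^ 2), integral_const_mul]
  ring

theorem tendsto_pow_mul_integral_sphereWeight_mul_inner_mul_sub (hρ : IsBoundedDensity ρ)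
    (hdiff : DifferentiableAt ℝ (radialExtension ρ) q) (t : Euc (m + 1)) :
    Tendsto (fun s : ℝ => s ^ m * (s ^ 2 * ∫ x, sphereWeight q s x *
        (⟪t, (x : Euc (m + 1)) - q⟫ * (ρ x - ρ q)) ∂surfaceMeasure (m + 1))) atTop
      (𝓝 (√(2 * Real.pi) ^ m * ⟪t, sphericalGradient ρ q⟫)) := by
  obtain ⟨M, hM⟩ := hρ.exists_abs_le
  obtain ⟨C, hC0, hC⟩ := exists_abs_sub_le_mul_norm_sub hM hdiff
  have hmeasρ := hρ.measurable
  set p := t - ⟪(q : Euc (m + 1)), t⟫ • (q : Euc (m + 1)) with hp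
  have hgaussian : ∫ u, ⟪p, u⟫ * ⟪sphericalGradient ρ q, u⟫ ∂stdGaussian (Euc (m + 1)) =
      ⟪t, sphericalGradient ρ q⟫ := by
    rw [integral_inner_mul_inner_stdGaussian, hp, inner_sub_left, real_inner_smul_left,
      real_inner_comm (sphericalGradient ρ q) (q : Euc (m + 1)),
      inner_sphericalGradient_self hdiff, mul_zero, sub_zero]
  rw [← hgaussian]
  refine (tendsto_pow_mul_integral_sphereWeight q
    (fun s x => s * ⟪t, (x : Euc (m + 1)) - q⟫ * (s * (ρ x - ρ q)))
    (fun u => ⟪p, u⟫ * ⟪sphericalGradient ρ q, u⟫) (‖t‖ * C) (fun s => by fun_prop)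
    (fun s x => ?_) fun u => ?_).congr fun s => ?_
  · calc |s * ⟪t, (x : Euc (m + 1)) - q⟫ * (s * (ρ x - ρ q))|
        ≤ ‖t‖ * |s * ‖(x : Euc (m + 1)) - q‖| * (|s| * (C * ‖(x : Euc (m + 1)) - q‖)) := by
          rw [abs_mul, abs_mul s (ρ x - ρ q)]
          gcongr
          · exact abs_mul_inner_sub_le q x s t
          · exact hC x
      _ = ‖t‖ * C * (s * ‖(x : Euc (m + 1)) - q‖) ^ 2 := by
          rw [abs_mul, abs_norm, mul_pow, ← sq_abs s]
          ring
      _ ≤ ‖t‖ * C * (1 + (s * ‖(x : Euc (m + 1)) - q‖) ^ 2) := by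
          gcongr
          linarith
  · simp only [radialExtension_mul _ fun x => _ * (ρ x - ρ q)]
    refine (tendsto_radialExtension_mul_inner_sub q t u).mul
      ((tendsto_mul_radialExtension_sub hdiff u).congr' ?_)
    filter_upwards [eventually_coe_add_inv_smul_ne_zero q u] with s hy
    simp only [radialExtension_of_ne_zero _ hy]
  · rw [← integral_const_mul (s ^ 2)]
    congr 2 with x
    ring

theorem tendsto_pow_mul_integral_sphereWeight_mul_inner_keyLaw (hρ : IsBoundedDensity ρ)
    (hdiff : DifferentiableAt ℝ (radialExtension ρ) q) (t : Euc (m + 1)) :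
    Tendsto (fun s : ℝ => s ^ m * (s ^ 2 * ∫ x, sphereWeight q s x *
        ⟪t, (x : Euc (m + 1)) - q⟫ ∂keyLaw ρ)) atTop
      (𝓝 (√(2 * Real.pi) ^ m * ⟪t, sphericalGradient ρ q⟫ +
        ρ q * (-(⟪t, (q : Euc (m + 1))⟫ / 2) * (√(2 * Real.pi) ^ m * m)))) := by
  obtain ⟨M, hM⟩ := hρ.exists_abs_le
  refine ((tendsto_pow_mul_integral_sphereWeight_mul_inner_mul_sub hρ hdiff t).add
    ((tendsto_pow_mul_integral_sphereWeight_mul_inner_sub q t).const_mul (ρ q))).congr fun s => ?_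
  have hint : Integrable (fun x => sphereWeight q s x * ⟪t, (x : Euc (m + 1)) - q⟫)
      (surfaceMeasure (m + 1)) :=
    Continuous.integrable_of_hasCompactSupport (by fun_prop) (HasCompactSupport.of_compactSpace _)
  have hintρ := hint.mul_bdd hρ.measurable.aestronglyMeasurable
    (ae_of_all _ fun x => (Real.norm_eq_abs (ρ x)).trans_le (hM x))
  have hsplit : ∫ x, sphereWeight q s x * (⟪t, (x : Euc (m + 1)) - q⟫ * (ρ x - ρ q))
        ∂surfaceMeasure (m + 1) =
      ∫ x, sphereWeight q s x * ⟪t, (x : Euc (m + 1)) - q⟫ * ρ x ∂surfaceMeasure (m + 1) -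
        (∫ x, sphereWeight q s x * ⟪t, (x : Euc (m + 1)) - q⟫ ∂surfaceMeasure (m + 1)) * ρ q := by
    rw [← integral_mul_const, ← integral_sub hintρ (hint.mul_const _)]
    congr 1 with x
    ring
  rw [integral_keyLaw hρ, hsplit]
  ring

theorem tendsto_sphereWeight_drift (hρ : IsBoundedDensity ρ)
    (hdiff : DifferentiableAt ℝ (radialExtension ρ) q) (hq : 0 < ρ q) (t : Euc (m + 1)) :
    Tendsto (fun s : ℝ => s ^ 2 * (∫ x, sphereWeight q s x * ⟪t, (x : Euc (m + 1)) - q⟫ ∂keyLaw ρ) /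
      meanSphereWeight ρ q s) atTop (𝓝 ⟪t, attnDrift ρ q⟫) := by
  have hlim := (tendsto_pow_mul_integral_sphereWeight_mul_inner_keyLaw hρ hdiff t).div
    (tendsto_pow_mul_meanSphereWeight hρ hdiff.continuousAt) (by positivity)
  convert hlim.congr' ?_ using 2
  · rw [attnDrift, sphericalGradient_log hdiff hq, inner_sub_right, real_inner_smul_right,
      real_inner_smul_right]
    push_cast
    field_simp
    ring
  · filter_upwards [eventually_gt_atTop 0] with s hs
    exact mul_div_mul_left _ _ (by positivity)

theorem covConst_succ (m : ℕ) :
    covConst (m + 1) = (2 * √2 ^ m * √(2 * Real.pi) ^ m)⁻¹ := by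
  have hpow : √2 ^ m * √(2 * Real.pi) ^ m = 2 ^ m * Real.pi ^ ((m : ℝ) / 2) := by
    rw [Real.sqrt_mul two_pos.le, ← mul_pow, ← mul_assoc, Real.mul_self_sqrt two_pos.le, mul_pow,
      Real.sqrt_eq_rpow, ← Real.rpow_mul_natCast Real.pi_pos.le, one_div_mul_eq_div]
  have hexp : -(((m + 1 : ℕ) : ℝ) - 1) / 2 = -((m : ℝ) / 2) := by push_cast; ring
  rw [mul_assoc, hpow, covConst, hexp, Real.rpow_neg two_pos.le, Real.rpow_natCast,
    Real.rpow_neg Real.pi_pos.le, ← mul_inv, pow_succ', mul_assoc]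

theorem tendsto_sphereWeight_covariance (hρ : IsBoundedDensity ρ)
    (hcont : ContinuousAt (radialExtension ρ) q) (hq : 0 < ρ q) (t : Euc (m + 1)) :
    Tendsto (fun s : ℝ => s ^ 2 * (∫ x, sphereWeight q s x ^ 2 *
        ⟪t, (x : Euc (m + 1)) - q⟫ ^ 2 ∂keyLaw ρ) /
          (s ^ m * meanSphereWeight ρ q s ^ 2)) atTop
      (𝓝 (covConst (m + 1) / ρ q * (‖t‖ ^ 2 - ⟪(q : Euc (m + 1)), t⟫ ^ 2))) := by
  have hlim := (tendsto_pow_mul_integral_sphereWeight_sq_mul_inner_sq_keyLaw hρ hcont t).div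
    ((tendsto_pow_mul_meanSphereWeight hρ hcont).pow 2) (by positivity)
  convert hlim.congr' ?_ using 2
  · rw [covConst_succ]
    field_simp
  · filter_upwards [eventually_gt_atTop 0] with s hs
    simp only [Pi.div_apply]
    field_simp

end Drift

theorem differentiableAt_radialExtension {m : ℕ} {ρ : USphere (m + 1) → ℝ} {n : WithTop ℕ∞}
    (hρ : ContMDiff (𝓡 m) 𝓘(ℝ, ℝ) n ρ) (hn : n ≠ 0) (q : USphere (m + 1)) :
    DifferentiableAt ℝ (radialExtension ρ) q := by
  let U : TopologicalSpace.Opens (Euc (m + 1)) := ⟨{0}ᶜ, isOpen_compl_singleton⟩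
  have : Fact (Module.finrank ℝ (Euc (m + 1)) = m + 1) := ⟨finrank_euclideanSpace_fin⟩
  have hnormalize : ContMDiff 𝓘(ℝ, Euc (m + 1)) 𝓘(ℝ, Euc (m + 1)) n
      fun y : U => normalize (y : Euc (m + 1)) := fun y =>
    (contMDiffAt_subtype_iff (f := fun y : Euc (m + 1) => normalize y)).2
      (((contDiffAt_norm ℝ y.2).inv (norm_ne_zero_iff.2 y.2)).smul contDiffAt_id).contMDiffAt
  have hext : ContMDiff 𝓘(ℝ, Euc (m + 1)) 𝓘(ℝ, ℝ) n fun y : U => radialExtension ρ y :=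
    (hρ.comp (hnormalize.codRestrict_sphere fun y => (radialProj y.1 y.2).2)).congr
      fun y => radialExtension_of_ne_zero ρ y.2
  exact (contMDiffAt_subtype_iff (U := U).1
    (hext ⟨q, ne_zero_of_mem_unit_sphere q⟩)).contDiffAt.differentiableAt hn

/-! ### Convergence to constants -/

section ConvergenceToConst

variable {Ω Ω' E F ι : Type*} [MeasurableSpace Ω] [MeasurableSpace Ω'] {P : Measure Ω}
  {l : Filter ι}

theorem tendstoInMeasure_of_tendstoInDistribution_const [PseudoEMetricSpace E]
    [MeasurableSpace E] [BorelSpace E] [IsProbabilityMeasure P] {P' : Measure Ω'}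
    [IsProbabilityMeasure P'] {X : ι → Ω → E} {c : E}
    (h : TendstoInDistribution X l (fun _ : Ω' => c) (fun _ => P) P') :
    TendstoInMeasure P X l (fun _ => c) := by
  intro ε hε
  set A : Set E := {y | ε ≤ edist y c}
  have hA : IsClosed A := isClosed_le continuous_const (by fun_prop)
  have hc : c ∉ A := by simp [A, hε.ne']
  have hlaw : P'.map (fun _ : Ω' => c) = Measure.dirac c := by simp [Measure.map_const]
  have hfrontier : (P'.map fun _ : Ω' => c) (frontier A) = 0 := by
    rw [hlaw, Measure.dirac_apply' _ isClosed_frontier.measurableSet]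
    exact Set.indicator_of_notMem (fun hf => hc (hA.frontier_subset hf)) _
  have hlim := ProbabilityMeasure.tendsto_measure_of_null_frontier_of_tendsto' h.tendsto hfrontier
  simp only [ProbabilityMeasure.coe_mk, hlaw, Measure.dirac_apply' _ hA.measurableSet,
    Set.indicator_of_notMem hc] at hlim
  refine hlim.congr fun i => ?_
  rw [Measure.map_apply_of_aemeasurable (h.forall_aemeasurable i) hA.measurableSet]
  rfl

theorem tendstoInMeasure_comp_of_continuousAt [PseudoEMetricSpace E] [PseudoEMetricSpace F]
    {X : ι → Ω → E} {c : E} (h : TendstoInMeasure P X l fun _ => c) {f : E → F}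
    (hf : ContinuousAt f c) :
    TendstoInMeasure P (fun i ω => f (X i ω)) l fun _ => f c := by
  intro ε hε
  obtain ⟨δ, hδ, hδε⟩ := EMetric.tendsto_nhds_nhds.1 hf ε hε
  refine tendsto_of_tendsto_of_tendsto_of_le_of_le tendsto_const_nhds (h δ hδ)
    (fun _ => zero_le) fun i => measure_mono fun ω hω => ?_
  exact not_lt.1 fun hlt => (hδε hlt).not_ge hω

theorem tendstoInDistribution_congr' [TopologicalSpace E] [MeasurableSpace E]
    [OpensMeasurableSpace E] [IsProbabilityMeasure P] {P' : Measure Ω'}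
    [IsProbabilityMeasure P'] {X Y : ι → Ω → E} {Z : Ω' → E}
    (h : TendstoInDistribution X l Z (fun _ => P) P') (hY : ∀ i, AEMeasurable (Y i) P)
    (hXY : ∀ᶠ i in l, X i = Y i) : TendstoInDistribution Y l Z (fun _ => P) P' where
  forall_aemeasurable := hY
  aemeasurable_limit := h.aemeasurable_limit
  tendsto := h.tendsto.congr' (hXY.mono fun _ hi => Subtype.ext (congrArg (P.map ·) hi))

end ConvergenceToConst

/-! ### Limit theorems for triangular arrays -/

section TriangularArray

theorem norm_cexp_mul_I_sub_taylor_le {y : ℝ} (hy : |y| ≤ 1) :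
    ‖Complex.exp (y * Complex.I) - (1 + y * Complex.I - y ^ 2 / 2)‖ ≤ |y| ^ 3 := by
  have hbound := Complex.exp_bound (x := y * Complex.I) (by simpa using hy) (n := 3) (by norm_num)
  have hsum : ∑ i ∈ Finset.range 3, ((y : ℂ) * Complex.I) ^ i / (i.factorial : ℂ) =
      1 + y * Complex.I - y ^ 2 / 2 := by
    simp [Finset.sum_range_succ, mul_pow, Nat.factorial]
    ring
  have hnorm : ‖(y : ℂ) * Complex.I‖ = |y| := by simp
  rw [hsum, hnorm] at hbound
  refine hbound.trans (mul_le_of_le_one_right (by positivity) ?_)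
  norm_num [Nat.factorial]

theorem norm_integral_cexp_mul_I_sub_taylor_le {S : Type*} [MeasurableSpace S] {κ : Measure S}
    [IsProbabilityMeasure κ] {g : S → ℝ} (hg : Measurable g) {ε : ℝ} (hε : ε ≤ 1)
    (hbound : ∀ y, |g y| ≤ ε) :
    ‖∫ y, Complex.exp (g y * Complex.I) ∂κ -
      (1 + (∫ y, g y ∂κ : ℝ) * Complex.I - (∫ y, g y ^ 2 ∂κ : ℝ) / 2)‖ ≤
      ε * ∫ y, g y ^ 2 ∂κ := by
  have hg_int : Integrable g κ :=
    .of_bound hg.aestronglyMeasurable ε (ae_of_all _ hbound)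
  have hsq_int : Integrable (fun y => g y ^ 2) κ :=
    .of_bound (hg.pow_const 2).aestronglyMeasurable (ε ^ 2) <| ae_of_all _ fun y => by
      simpa only [norm_pow] using pow_le_pow_left₀ (norm_nonneg _) (hbound y) 2
  have hexp_int : Integrable (fun y => Complex.exp (g y * Complex.I)) κ :=
    .of_bound (Measurable.aestronglyMeasurable (by fun_prop)) 1
      (ae_of_all _ fun y => (Complex.norm_exp_ofReal_mul_I _).le)
  have hlin_int : Integrable (fun y => 1 + (g y : ℂ) * Complex.I) κ :=
    (integrable_const _).add (hg_int.ofReal.mul_const _)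
  have hquad_int : Integrable (fun y => ((g y ^ 2 : ℝ) : ℂ) / 2) κ := hsq_int.ofReal.div_const 2
  have htaylor : ∫ y, Complex.exp (g y * Complex.I) ∂κ -
      (1 + (∫ y, g y ∂κ : ℝ) * Complex.I - (∫ y, g y ^ 2 ∂κ : ℝ) / 2) =
      ∫ y, (Complex.exp (g y * Complex.I) -
        (1 + g y * Complex.I - ((g y ^ 2 : ℝ) : ℂ) / 2)) ∂κ := by
    rw [integral_sub hexp_int ?_, integral_sub hlin_int hquad_int,
      integral_add (integrable_const _) (hg_int.ofReal.mul_const _), integral_mul_const,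
      integral_div, integral_complex_ofReal, integral_complex_ofReal]
    · simp
    · exact hlin_int.sub hquad_int
  rw [htaylor, ← integral_const_mul]
  refine norm_integral_le_of_norm_le (hsq_int.const_mul _) (ae_of_all _ fun y => ?_)
  push_cast
  calc _ ≤ |g y| ^ 3 := norm_cexp_mul_I_sub_taylor_le ((hbound y).trans hε)
    _ = |g y| * g y ^ 2 := by rw [pow_succ', sq_abs]
    _ ≤ ε * g y ^ 2 := by gcongr; exact hbound y

variable {Ω Ω' S E : Type*} [MeasurableSpace Ω] [MeasurableSpace Ω'] [MeasurableSpace S]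
  [NormedAddCommGroup E] [InnerProductSpace ℝ E] [MeasurableSpace E] [BorelSpace E]
  {P : Measure Ω} {P' : Measure Ω'} {κ : Measure S} {x : ℕ → Ω → S}

theorem charFun_map_sum_comp [SecondCountableTopology E] (hindep : iIndepFun x P)
    (hlaw : ∀ i, HasLaw (x i) κ P) {f : S → E} (hf : Measurable f) (n : ℕ) (t : E) :
    charFun (P.map fun ω => ∑ j ∈ Finset.range n, f (x j ω)) t =
      (∫ y, Complex.exp (⟪f y, t⟫ * Complex.I) ∂κ) ^ n := by
  have hprod := ((hindep.comp (fun _ => f) fun _ => hf).restrict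
    (Finset.range n)).charFun_map_fun_finsetSum_eq_prod
      fun j _ => hf.comp_aemeasurable (hlaw j).aemeasurable
  have hfactor (j : ℕ) : charFun (P.map fun ω => f (x j ω)) t =
      ∫ y, Complex.exp (⟪f y, t⟫ * Complex.I) ∂κ := by
    rw [← Function.comp_def f,
      ← AEMeasurable.map_map_of_aemeasurable hf.aemeasurable (hlaw j).aemeasurable, (hlaw j).map_eq,
      charFun_apply, integral_map hf.aemeasurable (Measurable.aestronglyMeasurable (by fun_prop))]
  simpa [hfactor, Function.comp_def] using congrFun hprod t

variable [IsProbabilityMeasure P] [IsProbabilityMeasure P']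

theorem tendsto_charFun_sum_of_small [SecondCountableTopology E] (hindep : iIndepFun x P)
    (hlaw : ∀ i, HasLaw (x i) κ P) {f : ℕ → S → E} (hf : ∀ n, Measurable (f n))
    {ε : ℕ → ℝ} (hε : Tendsto ε atTop (𝓝 0)) (hbound : ∀ᶠ n in atTop, ∀ y, ‖f n y‖ ≤ ε n)
    {t : E} {a b : ℝ}
    (ha : Tendsto (fun n : ℕ => n * ∫ y, ⟪f n y, t⟫ ∂κ) atTop (𝓝 a))
    (hb : Tendsto (fun n : ℕ => n * ∫ y, ⟪f n y, t⟫ ^ 2 ∂κ) atTop (𝓝 b)) :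
    Tendsto (fun n : ℕ => charFun (P.map fun ω => ∑ j ∈ Finset.range n, f n (x j ω)) t) atTop
      (𝓝 (Complex.exp (a * Complex.I - b / 2))) := by
  have : IsProbabilityMeasure κ := (hlaw 0).isProbabilityMeasure_iff.1 inferInstance
  have hεt : Tendsto (fun n => ε n * ‖t‖) atTop (𝓝 0) := by simpa using hε.mul_const ‖t‖
  set φ : ℕ → ℂ := fun n => ∫ y, Complex.exp (⟪f n y, t⟫ * Complex.I) ∂κ
  set taylor : ℕ → ℂ := fun n =>
    1 + (∫ y, ⟪f n y, t⟫ ∂κ : ℝ) * Complex.I - (∫ y, ⟪f n y, t⟫ ^ 2 ∂κ : ℝ) / 2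
  have hrem : Tendsto (fun n : ℕ => (n : ℂ) * (φ n - taylor n)) atTop (𝓝 0) := by
    refine squeeze_zero_norm' ?_ (by simpa using hεt.mul hb)
    filter_upwards [hεt.eventually (ge_mem_nhds one_pos), hbound] with n hn hbn
    have hinner (y : S) : |⟪f n y, t⟫| ≤ ε n * ‖t‖ :=
      (abs_real_inner_le_norm _ _).trans (by gcongr; exact hbn y)
    rw [norm_mul, Complex.norm_natCast, mul_left_comm]
    gcongr
    exact norm_integral_cexp_mul_I_sub_taylor_le (hf n).inner_const hn hinner
  have htaylor : Tendsto (fun n : ℕ => (n : ℂ) * (taylor n - 1)) atTop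
      (𝓝 (a * Complex.I - b / 2)) := by
    refine ((((Complex.continuous_ofReal.tendsto _).comp ha).mul_const _).sub
      (((Complex.continuous_ofReal.tendsto _).comp hb).div_const _)).congr fun n => ?_
    simp only [taylor, Function.comp, Complex.ofReal_mul, Complex.ofReal_natCast]
    ring
  have hφ : Tendsto (fun n : ℕ => (1 + (φ n - 1)) ^ n) atTop
      (𝓝 (Complex.exp (a * Complex.I - b / 2))) := by
    refine Complex.tendsto_one_add_pow_exp_of_tendsto ?_
    simpa only [zero_add, ← mul_add, sub_add_sub_cancel] using hrem.add htaylor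
  simpa only [charFun_map_sum_comp hindep hlaw (hf _), add_sub_cancel] using hφ

theorem tendstoInDistribution_sum_of_small [FiniteDimensional ℝ E] (hindep : iIndepFun x P)
    (hlaw : ∀ i, HasLaw (x i) κ P) {f : ℕ → S → E} (hf : ∀ n, Measurable (f n))
    {ε : ℕ → ℝ} (hε : Tendsto ε atTop (𝓝 0)) (hbound : ∀ᶠ n in atTop, ∀ y, ‖f n y‖ ≤ ε n)
    {a b : E → ℝ}
    (ha : ∀ t, Tendsto (fun n : ℕ => n * ∫ y, ⟪f n y, t⟫ ∂κ) atTop (𝓝 (a t)))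
    (hb : ∀ t, Tendsto (fun n : ℕ => n * ∫ y, ⟪f n y, t⟫ ^ 2 ∂κ) atTop (𝓝 (b t)))
    {Z : Ω' → E} (hZ : AEMeasurable Z P')
    (hcharFun : ∀ t, charFun (P'.map Z) t = Complex.exp (a t * Complex.I - b t / 2)) :
    TendstoInDistribution (fun (n : ℕ) ω => ∑ j ∈ Finset.range n, f n (x j ω)) atTop Z
      (fun _ => P) P' where
  forall_aemeasurable n :=
    Finset.aemeasurable_fun_sum _ fun j _ => (hf n).comp_aemeasurable (hlaw j).aemeasurable
  aemeasurable_limit := hZ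
  tendsto := ProbabilityMeasure.tendsto_iff_tendsto_charFun.2 fun t => by
    simpa only [ProbabilityMeasure.coe_mk, hcharFun] using
      tendsto_charFun_sum_of_small hindep hlaw hf hε hbound (ha t) (hb t)

theorem tendstoInMeasure_sum_of_small_of_nonneg (hindep : iIndepFun x P)
    (hlaw : ∀ i, HasLaw (x i) κ P) {f : ℕ → S → ℝ} (hf : ∀ n, Measurable (f n))
    (hnonneg : ∀ n y, 0 ≤ f n y) {ε : ℕ → ℝ} (hε : Tendsto ε atTop (𝓝 0))
    (hbound : ∀ᶠ n in atTop, ∀ y, f n y ≤ ε n) {a : ℝ}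
    (ha : Tendsto (fun n : ℕ => n * ∫ y, f n y ∂κ) atTop (𝓝 a)) :
    TendstoInMeasure P (fun (n : ℕ) ω => ∑ j ∈ Finset.range n, f n (x j ω)) atTop
      (fun _ => a) := by
  have : IsProbabilityMeasure κ := (hlaw 0).isProbabilityMeasure_iff.1 inferInstance
  have hsq : Tendsto (fun n : ℕ => n * ∫ y, f n y ^ 2 ∂κ) atTop (𝓝 0) := by
    refine tendsto_of_tendsto_of_tendsto_of_le_of_le' tendsto_const_nhds
      (by simpa using hε.mul ha)
      (.of_forall fun n => mul_nonneg n.cast_nonneg (integral_nonneg fun y => sq_nonneg _)) ?_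
    filter_upwards [hbound] with n hbn
    have hint : Integrable (f n) κ := .of_bound (hf n).aestronglyMeasurable (ε n)
      (ae_of_all _ fun y => (Real.norm_of_nonneg (hnonneg n y)).trans_le (hbn y))
    rw [mul_left_comm, ← integral_const_mul (ε n)]
    refine mul_le_mul_of_nonneg_left (integral_mono_of_nonneg (ae_of_all _ fun y => sq_nonneg _)
      (hint.const_mul _) (ae_of_all _ fun y => ?_)) n.cast_nonneg
    simpa only [sq] using mul_le_mul_of_nonneg_right (hbn y) (hnonneg n y)
  refine tendstoInMeasure_of_tendstoInDistribution_const (P' := P)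
    (tendstoInDistribution_sum_of_small hindep hlaw hf hε (a := fun t => a * t) (b := fun _ => 0)
      ?_ (fun t => ?_) (fun t => ?_) aemeasurable_const fun t => ?_)
  · simpa only [Real.norm_of_nonneg (hnonneg _ _)] using hbound
  · simpa only [Real.inner_apply, integral_mul_const, ← mul_assoc] using ha.mul_const t
  · simpa [mul_pow, integral_const_mul, mul_left_comm] using hsq.const_mul (t ^ 2)
  · rw [Measure.map_const, measure_univ, one_smul, charFun_dirac]
    simp [mul_comm]

end TriangularArray

/-! ### The limiting covariance -/

section Covariance

variable {d : ℕ} {ρ : USphere d → ℝ} {q : USphere d}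

theorem inner_toEuclideanCLM_left (V : Matrix (Fin d) (Fin d) ℝ) (u t : Euc d) :
    ⟪Matrix.toEuclideanCLM (𝕜 := ℝ) V u, t⟫ =
      ⟪u, Matrix.toEuclideanCLM (𝕜 := ℝ) V.transpose t⟫ := by
  rw [← Matrix.conjTranspose_eq_transpose_of_trivial, ← Matrix.star_eq_conjTranspose, map_star]
  exact (ContinuousLinearMap.adjoint_inner_right _ u t).symm

theorem toEuclideanCLM_tangentProj (q : USphere d) (u : Euc d) :
    Matrix.toEuclideanCLM (𝕜 := ℝ) (tangentProj q) u = u - ⟪(q : Euc d), u⟫ • (q : Euc d) := by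
  ext i
  simp [tangentProj, Matrix.vecMulVec_mulVec, PiLp.inner_apply, dotProduct,
    mul_comm]

theorem inner_toEuclideanCLM_tangentProj (q : USphere d) (u : Euc d) :
    ⟪u, Matrix.toEuclideanCLM (𝕜 := ℝ) (tangentProj q) u⟫ = ‖u‖ ^ 2 - ⟪(q : Euc d), u⟫ ^ 2 := by
  rw [toEuclideanCLM_tangentProj, inner_sub_right, real_inner_smul_right,
    real_inner_self_eq_norm_sq, real_inner_comm, sq ⟪_, _⟫]

theorem posSemidef_tangentProj (q : USphere d) : (tangentProj q).PosSemidef := by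
  refine .of_dotProduct_mulVec_nonneg ?_ fun v => ?_
  · rw [Matrix.IsHermitian, Matrix.conjTranspose_eq_transpose_of_trivial, tangentProj,
      Matrix.transpose_sub, Matrix.transpose_one, Matrix.transpose_vecMulVec]
  · have hinner := Matrix.inner_toEuclideanCLM (tangentProj q) (WithLp.toLp 2 v) (WithLp.toLp 2 v)
    rw [inner_toEuclideanCLM_tangentProj, ← norm_sub_inner_smul_sq (norm_eq_of_mem_sphere q)]
      at hinner
    exact (sq_nonneg _).trans_eq hinner

theorem posSemidef_attnCov (hq : 0 < ρ q) : (attnCov ρ q).PosSemidef :=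
  (posSemidef_tangentProj q).smul (div_nonneg (by unfold covConst; positivity) hq.le)

theorem dotProduct_mulVec_attnCov (V : Matrix (Fin d) (Fin d) ℝ) (t : Euc d) :
    t.ofLp ⬝ᵥ (V * attnCov ρ q * V.transpose).mulVec t.ofLp =
      covConst d / ρ q * (‖Matrix.toEuclideanCLM (𝕜 := ℝ) V.transpose t‖ ^ 2 -
        ⟪(q : Euc d), Matrix.toEuclideanCLM (𝕜 := ℝ) V.transpose t⟫ ^ 2) := by
  rw [← Matrix.inner_toEuclideanCLM, map_mul, map_mul, attnCov, map_smul, mul_apply_eq_comp,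
    mul_apply_eq_comp, real_inner_comm, inner_toEuclideanCLM_left, _root_.smul_apply,
    real_inner_smul_left, real_inner_comm, inner_toEuclideanCLM_tangentProj]

theorem charFun_const_add_multivariateGaussian_attnCov (hq : 0 < ρ q)
    (V : Matrix (Fin d) (Fin d) ℝ) {b : ℝ} (hb : 0 ≤ b) (v t : Euc d) :
    charFun ((multivariateGaussian 0 (b • (V * attnCov ρ q * V.transpose))).map (v + ·)) t =
      Complex.exp (⟪v, t⟫ * Complex.I -
        (b * (covConst d / ρ q * (‖Matrix.toEuclideanCLM (𝕜 := ℝ) V.transpose t‖ ^ 2 -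
          ⟪(q : Euc d), Matrix.toEuclideanCLM (𝕜 := ℝ) V.transpose t⟫ ^ 2)) : ℝ) / 2) := by
  have hcov := (posSemidef_attnCov hq).mul_mul_conjTranspose_same V
  rw [Matrix.conjTranspose_eq_transpose_of_trivial] at hcov
  rw [charFun_map_const_add, charFun_multivariateGaussian (hcov.smul hb), Matrix.smul_mulVec,
    dotProduct_smul, dotProduct_mulVec_attnCov, inner_zero_right, ← Complex.exp_add, smul_eq_mul,
    real_inner_comm t v]
  congr 1
  push_cast
  ring

end Covariance

/-! ### Attention as a ratio of sums of independent terms -/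

section Ratio

variable {d : ℕ}

theorem attnWeight_sq (s : ℝ) (q : USphere d) (x : ℕ → USphere d) (n j : ℕ) :
    attnWeight (s ^ 2) q x n j =
      (∑ l ∈ Finset.range n, sphereWeight q s (x l))⁻¹ * sphereWeight q s (x j) := by
  have hexp (y : USphere d) : Real.exp (s ^ 2 * ⟪(q : Euc d), (y : Euc d)⟫) =
      Real.exp (s ^ 2) * sphereWeight q s y := by
    rw [sphereWeight_eq_exp_inner, ← Real.exp_add, add_sub_cancel]
  simp only [attnWeight, hexp]
  rw [← Finset.mul_sum, mul_div_mul_left _ _ (Real.exp_ne_zero _), div_eq_inv_mul]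

theorem attnDisplacement_sq (s : ℝ) (V : Matrix (Fin d) (Fin d) ℝ) (q : USphere d)
    (x : ℕ → USphere d) {n : ℕ} (hn : n ≠ 0) :
    attnDisplacement (s ^ 2) V q x n = (∑ j ∈ Finset.range n, sphereWeight q s (x j))⁻¹ •
      ∑ j ∈ Finset.range n, sphereWeight q s (x j) •
        Matrix.toEuclideanCLM (𝕜 := ℝ) V ((x j : Euc d) - q) := by
  have hpos : 0 < ∑ j ∈ Finset.range n, sphereWeight q s (x j) :=
    Finset.sum_pos (fun j _ => sphereWeight_pos q s _) (Finset.nonempty_range_iff.mpr hn)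
  simp_rw [attnDisplacement, attnOutput, ← map_sub, ← map_smul, ← map_sum, ← map_smul,
    attnWeight_sq, smul_sub, Finset.sum_sub_distrib, ← Finset.sum_smul, smul_sub, smul_smul,
    inv_mul_cancel₀ hpos.ne', one_smul, Finset.smul_sum, smul_smul]

variable {Ω : Type*} [MeasurableSpace Ω] {P : Measure Ω} {x : ℕ → Ω → USphere d}

theorem aemeasurable_attnDisplacement (hx : ∀ i, AEMeasurable (x i) P) (β : ℝ)
    (V : Matrix (Fin d) (Fin d) ℝ) (q : USphere d) (n : ℕ) :
    AEMeasurable (fun ω => attnDisplacement β V q (fun i => x i ω) n) P := by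
  have hmeas : Measurable fun y : ℕ → USphere d => attnDisplacement β V q y n := by
    unfold attnDisplacement attnOutput attnWeight
    fun_prop
  exact hmeas.comp_aemeasurable (aemeasurable_pi_lambda _ hx)

end Ratio

/-! ### Limit theorem for the rescaled displacement -/

theorem mul_sphereWeight_mul_norm_sub_le_one {d : ℕ} (q : USphere d) (s : ℝ) (x : USphere d) :
    s * (sphereWeight q s x * ‖(x : Euc d) - q‖) ≤ 1 := by
  set u := s * ‖(x : Euc d) - q‖ with hu
  have hexp : u ≤ Real.exp (u ^ 2 / 2) := by
    nlinarith [Real.add_one_le_exp (u ^ 2 / 2), sq_nonneg (u - 1)]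
  calc s * (sphereWeight q s x * ‖(x : Euc d) - q‖) = u * Real.exp (-u ^ 2 / 2) := by
        rw [sphereWeight, ← hu, hu]; ring
    _ ≤ Real.exp (u ^ 2 / 2) * Real.exp (-u ^ 2 / 2) := by gcongr
    _ = 1 := by rw [← Real.exp_add, neg_div, add_neg_cancel, Real.exp_zero]

theorem norm_smul_sphereWeight_smul_map_sub_le {d : ℕ} {F : Type*} [NormedAddCommGroup F]
    [NormedSpace ℝ F] (T : Euc d →L[ℝ] F) (q : USphere d) {s : ℝ} (hs : 0 < s) (k : ℝ)
    (x : USphere d) : ‖k • sphereWeight q s x • T ((x : Euc d) - q)‖ ≤ |k / s| * ‖T‖ := by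
  rw [norm_smul, norm_smul, Real.norm_eq_abs, Real.norm_of_nonneg (sphereWeight_pos q s x).le,
    abs_div, abs_of_pos hs]
  calc |k| * (sphereWeight q s x * ‖T ((x : Euc d) - q)‖)
      ≤ |k| * (sphereWeight q s x * (‖T‖ * ‖(x : Euc d) - q‖)) := by
        have := (sphereWeight_pos q s x).le
        gcongr
        exact T.le_opNorm _
    _ = |k| / s * ‖T‖ * (s * (sphereWeight q s x * ‖(x : Euc d) - q‖)) := by field_simp
    _ ≤ |k| / s * ‖T‖ :=
        mul_le_of_le_one_right (by positivity) (mul_sphereWeight_mul_norm_sub_le_one q s x)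

section Limit

variable {m : ℕ} {Ω : Type*} [MeasurableSpace Ω] {P : Measure Ω} [IsProbabilityMeasure P]
  {q : USphere (m + 1)} {ρ : USphere (m + 1) → ℝ} {x : ℕ → Ω → USphere (m + 1)} {s c : ℕ → ℝ}
  {a b : ℝ}

theorem eventually_pos_of_tendsto_atTop (hρ : IsBoundedDensity ρ)
    (hcont : ContinuousAt (radialExtension ρ) q) (hq : 0 < ρ q) (hs : Tendsto s atTop atTop) :
    ∀ᶠ n : ℕ in atTop, 0 < (n : ℝ) ∧ 0 < s n ∧ 0 < meanSphereWeight ρ q (s n) := by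
  filter_upwards [eventually_gt_atTop 0, hs.eventually_gt_atTop 0,
    hs.eventually (eventually_meanSphereWeight_pos hρ hcont hq)] with n hn hsn hμ
  exact ⟨Nat.cast_pos.2 hn, hsn, hμ⟩

theorem tendstoInMeasure_sum_sphereWeight_div (hρ : IsBoundedDensity ρ)
    (hcont : ContinuousAt (radialExtension ρ) q) (hq : 0 < ρ q) (hindep : iIndepFun x P)
    (hlaw : ∀ i, HasLaw (x i) (keyLaw ρ) P) (hs : Tendsto s atTop atTop)
    (hden : Tendsto (fun n : ℕ => s n ^ m / n) atTop (𝓝 0)) :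
    TendstoInMeasure P (fun (n : ℕ) ω => ∑ j ∈ Finset.range n,
      sphereWeight q (s n) (x j ω) / (n * meanSphereWeight ρ q (s n))) atTop (fun _ => 1) := by
  have hpos := eventually_pos_of_tendsto_atTop hρ hcont hq hs
  have hε : Tendsto (fun n : ℕ => (n * meanSphereWeight ρ q (s n))⁻¹) atTop (𝓝 0) := by
    have hlim := hden.div ((tendsto_pow_mul_meanSphereWeight hρ hcont).comp hs) (by positivity)
    rw [zero_div] at hlim
    refine hlim.congr' ?_
    filter_upwards [hpos] with n ⟨hn, hsn, hμ⟩
    simp only [Pi.div_apply, Function.comp]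
    field_simp
  refine tendstoInMeasure_sum_of_small_of_nonneg
    (f := fun (n : ℕ) y => sphereWeight q (s n) y / (n * meanSphereWeight ρ q (s n)))
    hindep hlaw (fun n => (continuous_sphereWeight q _).measurable.div_const _)
    (fun n y => div_nonneg (sphereWeight_pos q _ y).le (mul_nonneg n.cast_nonneg
      (integral_nonneg fun z => (sphereWeight_pos q _ z).le))) hε ?_ ?_
  · filter_upwards [hpos] with n ⟨hn, _, hμ⟩ y
    rw [← one_div]
    gcongr
    exact sphereWeight_le_one q _ y
  · refine tendsto_const_nhds.congr' ?_
    filter_upwards [hpos] with n ⟨hn, _, hμ⟩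
    rw [integral_div, ← meanSphereWeight]
    field_simp

theorem tendsto_abs_div_meanSphereWeight (hρ : IsBoundedDensity ρ)
    (hcont : ContinuousAt (radialExtension ρ) q) (hq : 0 < ρ q) (hs : Tendsto s atTop atTop)
    (hden : Tendsto (fun n : ℕ => s n ^ m / n) atTop (𝓝 0))
    (hb : Tendsto (fun n : ℕ => c n ^ 2 * s n ^ m / (n * s n ^ 2)) atTop (𝓝 b)) :
    Tendsto (fun n : ℕ => |c n / (n * meanSphereWeight ρ q (s n)) / s n|) atTop (𝓝 0) := by
  have hlim := ((hb.mul hden).div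
    (((tendsto_pow_mul_meanSphereWeight hρ hcont).comp hs).pow 2) (by positivity)).sqrt
  rw [mul_zero, zero_div, Real.sqrt_zero] at hlim
  refine hlim.congr' ?_
  filter_upwards [eventually_pos_of_tendsto_atTop hρ hcont hq hs] with n ⟨_, hsn, _⟩
  rw [← Real.sqrt_sq_eq_abs]
  simp only [Pi.div_apply, Function.comp]
  field_simp

theorem tendstoInDistribution_sum_smul_sphereWeight (hρ : IsBoundedDensity ρ)
    (hdiff : DifferentiableAt ℝ (radialExtension ρ) q) (hq : 0 < ρ q) (hindep : iIndepFun x P)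
    (hlaw : ∀ i, HasLaw (x i) (keyLaw ρ) P) (V : Matrix (Fin (m + 1)) (Fin (m + 1)) ℝ)
    (hs : Tendsto s atTop atTop) (hden : Tendsto (fun n : ℕ => s n ^ m / n) atTop (𝓝 0))
    (hb0 : 0 ≤ b) (ha : Tendsto (fun n => c n / s n ^ 2) atTop (𝓝 a))
    (hb : Tendsto (fun n : ℕ => c n ^ 2 * s n ^ m / (n * s n ^ 2)) atTop (𝓝 b)) :
    TendstoInDistribution (fun (n : ℕ) ω => ∑ j ∈ Finset.range n,
        (c n / (n * meanSphereWeight ρ q (s n))) • sphereWeight q (s n) (x j ω) •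
          Matrix.toEuclideanCLM (𝕜 := ℝ) V ((x j ω : Euc (m + 1)) - q)) atTop
      (fun z => a • Matrix.toEuclideanCLM (𝕜 := ℝ) V (attnDrift ρ q) + z) (fun _ => P)
      (multivariateGaussian 0 (b • (V * attnCov ρ q * V.transpose))) := by
  have hpos := eventually_pos_of_tendsto_atTop hρ hdiff.continuousAt hq hs
  set T := Matrix.toEuclideanCLM (𝕜 := ℝ) V
  set Tt := Matrix.toEuclideanCLM (𝕜 := ℝ) V.transpose
  have hinner (n : ℕ) (y : USphere (m + 1)) (t : Euc (m + 1)) :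
      ⟪(c n / (n * meanSphereWeight ρ q (s n))) • sphereWeight q (s n) y •
        T ((y : Euc (m + 1)) - q), t⟫ = c n / (n * meanSphereWeight ρ q (s n)) *
          (sphereWeight q (s n) y * ⟪Tt t, (y : Euc (m + 1)) - q⟫) := by
    rw [real_inner_smul_left, real_inner_smul_left, inner_toEuclideanCLM_left, real_inner_comm]
  refine tendstoInDistribution_sum_of_small hindep hlaw
    (f := fun n y => (c n / (n * meanSphereWeight ρ q (s n))) • sphereWeight q (s n) y •
      T ((y : Euc (m + 1)) - q))
    (a := fun t => a * ⟪Tt t, attnDrift ρ q⟫)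
    (b := fun t => b * (covConst (m + 1) / ρ q *
      (‖Tt t‖ ^ 2 - ⟪(q : Euc (m + 1)), Tt t⟫ ^ 2)))
    (fun n => Continuous.measurable (by fun_prop))
    (ε := fun n => |c n / (n * meanSphereWeight ρ q (s n)) / s n| * ‖T‖)
    (by simpa using (tendsto_abs_div_meanSphereWeight hρ hdiff.continuousAt hq hs hden
      hb).mul_const ‖T‖) ?_ (fun t => ?_) (fun t => ?_) (by fun_prop) fun t => ?_
  · filter_upwards [hpos] with n ⟨_, hsn, _⟩ y
    exact norm_smul_sphereWeight_smul_map_sub_le T q hsn _ y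
  · refine (ha.mul ((tendsto_sphereWeight_drift hρ hdiff hq (Tt t)).comp hs)).congr' ?_
    filter_upwards [hpos] with n ⟨hn, hsn, hμ⟩
    simp only [hinner, integral_const_mul, Function.comp]
    field_simp
  · refine (hb.mul ((tendsto_sphereWeight_covariance hρ hdiff.continuousAt hq
      (Tt t)).comp hs)).congr' ?_
    filter_upwards [hpos] with n ⟨hn, hsn, hμ⟩
    simp only [hinner, mul_pow, integral_const_mul, Function.comp]
    field_simp
  · rw [charFun_const_add_multivariateGaussian_attnCov hq V hb0, real_inner_smul_left,
      inner_toEuclideanCLM_left, real_inner_comm]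

theorem tendstoInDistribution_smul_attnDisplacement_sq (hρ : IsBoundedDensity ρ)
    (hdiff : DifferentiableAt ℝ (radialExtension ρ) q) (hq : 0 < ρ q) (hindep : iIndepFun x P)
    (hlaw : ∀ i, HasLaw (x i) (keyLaw ρ) P) (V : Matrix (Fin (m + 1)) (Fin (m + 1)) ℝ)
    (hs : Tendsto s atTop atTop) (hden : Tendsto (fun n : ℕ => s n ^ m / n) atTop (𝓝 0))
    (hb0 : 0 ≤ b) (ha : Tendsto (fun n => c n / s n ^ 2) atTop (𝓝 a))
    (hb : Tendsto (fun n : ℕ => c n ^ 2 * s n ^ m / (n * s n ^ 2)) atTop (𝓝 b)) :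
    TendstoInDistribution (fun n ω => c n • attnDisplacement (s n ^ 2) V q (fun i => x i ω) n)
      atTop (fun z => a • Matrix.toEuclideanCLM (𝕜 := ℝ) V (attnDrift ρ q) + z) (fun _ => P)
      (multivariateGaussian 0 (b • (V * attnCov ρ q * V.transpose))) := by
  have hinv := tendstoInMeasure_comp_of_continuousAt
    (tendstoInMeasure_sum_sphereWeight_div hρ hdiff.continuousAt hq hindep hlaw hs hden)
    (continuousAt_inv₀ one_ne_zero)
  have hx (i : ℕ) : AEMeasurable (x i) P := (hlaw i).aemeasurable
  have hslutsky := (tendstoInDistribution_sum_smul_sphereWeight hρ hdiff hq hindep hlaw V hs hden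
    hb0 ha hb).continuous_comp_prodMk_of_tendstoInMeasure_const
      (g := fun z : Euc (m + 1) × ℝ => z.2 • z.1) (by fun_prop) hinv fun n =>
        (Finset.aemeasurable_fun_sum _ fun j _ =>
          ((continuous_sphereWeight q _).measurable.comp_aemeasurable (hx j)).div_const _).inv
  simp only [inv_one, one_smul] at hslutsky
  refine tendstoInDistribution_congr' hslutsky
    (fun n => (aemeasurable_attnDisplacement hx _ _ _ _).fun_const_smul _) ?_
  filter_upwards [eventually_pos_of_tendsto_atTop hρ hdiff.continuousAt hq hs]
    with n ⟨hn, _, _⟩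
  funext ω
  rw [attnDisplacement_sq _ _ _ _ (Nat.cast_pos.1 hn).ne', ← Finset.sum_div, inv_div,
    ← Finset.smul_sum, smul_smul, smul_smul]
  congr 1
  field_simp

theorem tendstoInDistribution_smul_attnDisplacement (hρ : IsBoundedDensity ρ)
    (hdiff : DifferentiableAt ℝ (radialExtension ρ) q) (hq : 0 < ρ q) (hindep : iIndepFun x P)
    (hlaw : ∀ i, HasLaw (x i) (keyLaw ρ) P) (V : Matrix (Fin (m + 1)) (Fin (m + 1)) ℝ)
    {β : ℕ → ℝ} (hβ : Tendsto β atTop atTop)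
    (hden : Tendsto (fun n : ℕ => √(β n) ^ m / n) atTop (𝓝 0)) (hb0 : 0 ≤ b)
    (ha : Tendsto (fun n => c n / β n) atTop (𝓝 a))
    (hb : Tendsto (fun n : ℕ => c n ^ 2 * √(β n) ^ m / (n * β n)) atTop (𝓝 b)) :
    TendstoInDistribution (fun n ω => c n • attnDisplacement (β n) V q (fun i => x i ω) n)
      atTop (fun z => a • Matrix.toEuclideanCLM (𝕜 := ℝ) V (attnDrift ρ q) + z) (fun _ => P)
      (multivariateGaussian 0 (b • (V * attnCov ρ q * V.transpose))) := by
  have hsq : ∀ᶠ n in atTop, √(β n) ^ 2 = β n :=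
    (hβ.eventually_ge_atTop 0).mono fun n hn => Real.sq_sqrt hn
  refine tendstoInDistribution_congr' (tendstoInDistribution_smul_attnDisplacement_sq (c := c) hρ
    hdiff hq hindep hlaw V (Real.tendsto_sqrt_atTop.comp hβ) hden hb0 (ha.congr' ?_)
    (hb.congr' ?_))
    (fun n => (aemeasurable_attnDisplacement (fun i => (hlaw i).aemeasurable)
      _ _ _ _).fun_const_smul _) ?_
  all_goals
    filter_upwards [hsq] with n hn
    simp only [Function.comp, hn]

theorem tendstoInMeasure_smul_attnDisplacement (hρ : IsBoundedDensity ρ)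
    (hdiff : DifferentiableAt ℝ (radialExtension ρ) q) (hq : 0 < ρ q) (hindep : iIndepFun x P)
    (hlaw : ∀ i, HasLaw (x i) (keyLaw ρ) P) (V : Matrix (Fin (m + 1)) (Fin (m + 1)) ℝ)
    {β : ℕ → ℝ} (hβ : Tendsto β atTop atTop)
    (hden : Tendsto (fun n : ℕ => √(β n) ^ m / n) atTop (𝓝 0))
    (ha : Tendsto (fun n => c n / β n) atTop (𝓝 a))
    (hb : Tendsto (fun n : ℕ => c n ^ 2 * √(β n) ^ m / (n * β n)) atTop (𝓝 0)) :
    TendstoInMeasure P (fun n ω => c n • attnDisplacement (β n) V q (fun i => x i ω) n) atTop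
      (fun _ => a • Matrix.toEuclideanCLM (𝕜 := ℝ) V (attnDrift ρ q)) := by
  have hdirac : multivariateGaussian (0 : Euc (m + 1))
      ((0 : ℝ) • (V * attnCov ρ q * V.transpose)) = Measure.dirac 0 := by
    simp [multivariateGaussian]
  have hlim := tendstoInDistribution_smul_attnDisplacement hρ hdiff hq hindep hlaw V hβ hden
    le_rfl ha hb
  refine tendstoInMeasure_of_tendstoInDistribution_const
    (hlim.congr (fun _ => ae_eq_refl _) ?_)
  rw [hdirac, EventuallyEq, ae_dirac_eq, eventually_pure, add_zero]

end Limit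

/-! ### Rates -/

section Rates

variable {m : ℕ} {β : ℕ → ℝ}

theorem one_div_alphaExp_succ (m : ℕ) : 1 / alphaExp (m + 1) = m / 2 := by
  simp [alphaExp]

theorem alphaExp_succ_pos (hm : 1 ≤ m) : 0 < alphaExp (m + 1) := by
  rw [← one_div_pos, one_div_alphaExp_succ]
  positivity

theorem sqrt_pow_eq_rpow_one_div_alphaExp {b : ℝ} (hb : 0 ≤ b) :
    √b ^ m = b ^ (1 / alphaExp (m + 1)) := by
  rw [one_div_alphaExp_succ, Real.rpow_div_two_eq_sqrt _ hb, Real.rpow_natCast]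

theorem mul_rpow_neg_rpow_one_div {b y α : ℝ} (hb : 0 ≤ b) (hy : 0 ≤ y) (hα : α ≠ 0) :
    (b * y ^ (-α)) ^ (1 / α) = b ^ (1 / α) / y := by
  rw [Real.mul_rpow hb (by positivity), ← Real.rpow_mul hy, neg_mul, mul_one_div_cancel hα,
    Real.rpow_neg_one, ← div_eq_mul_inv]

theorem rpow_one_add_rpow_one_div {b α : ℝ} (hb : 0 < b) (hα : α ≠ 0) :
    (b ^ (1 + α)) ^ (1 / α) = b * b ^ (1 / α) := by
  rw [← Real.rpow_mul hb.le, add_mul, one_mul, mul_one_div_cancel hα, Real.rpow_add hb,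
    Real.rpow_one, mul_comm]

theorem eventually_natCast_pos_and_pos (hβ : Tendsto β atTop atTop) :
    ∀ᶠ n : ℕ in atTop, 0 < (n : ℝ) ∧ 0 < β n := by
  filter_upwards [eventually_gt_atTop 0, hβ.eventually_gt_atTop 0] with n hn hβn
  exact ⟨Nat.cast_pos.2 hn, hβn⟩

theorem tendsto_sqrt_pow_div (hm : 1 ≤ m) (hβ : Tendsto β atTop atTop)
    (hβ_sub : Tendsto (fun n : ℕ => β n * (n : ℝ) ^ (-alphaExp (m + 1))) atTop (𝓝 0)) :
    Tendsto (fun n : ℕ => √(β n) ^ m / n) atTop (𝓝 0) := by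
  have hα := alphaExp_succ_pos hm
  have hlim := hβ_sub.rpow_const (Or.inr (one_div_pos.2 hα).le)
  rw [Real.zero_rpow (one_div_pos.2 hα).ne'] at hlim
  refine hlim.congr' ?_
  filter_upwards [eventually_natCast_pos_and_pos hβ] with n ⟨hn, hβn⟩
  rw [mul_rpow_neg_rpow_one_div hβn.le hn.le hα.ne', sqrt_pow_eq_rpow_one_div_alphaExp hβn.le]

theorem rpow_one_add_mul_rpow_neg_rpow_one_div_alphaExp (hm : 1 ≤ m) {b y : ℝ} (hb : 0 < b)
    (hy : 0 ≤ y) :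
    (b ^ (1 + alphaExp (m + 1)) * y ^ (-alphaExp (m + 1))) ^ (1 / alphaExp (m + 1)) =
      b * √b ^ m / y := by
  have hα := (alphaExp_succ_pos hm).ne'
  rw [mul_rpow_neg_rpow_one_div (by positivity) hy hα, rpow_one_add_rpow_one_div hb hα,
    sqrt_pow_eq_rpow_one_div_alphaExp hb.le]

theorem tendsto_sq_mul_sqrt_pow_div (hm : 1 ≤ m) (hβ : Tendsto β atTop atTop) {τ : ℝ}
    (hτ : Tendsto (fun n : ℕ => β n ^ (1 + alphaExp (m + 1)) * (n : ℝ) ^ (-alphaExp (m + 1)))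
      atTop (𝓝 τ)) :
    Tendsto (fun n : ℕ => β n ^ 2 * √(β n) ^ m / (n * β n)) atTop
      (𝓝 (τ ^ (1 / alphaExp (m + 1)))) := by
  refine (hτ.rpow_const (Or.inr (one_div_pos.2 (alphaExp_succ_pos hm)).le)).congr' ?_
  filter_upwards [eventually_natCast_pos_and_pos hβ] with n ⟨hn, hβn⟩
  rw [rpow_one_add_mul_rpow_neg_rpow_one_div_alphaExp hm hβn hn.le]
  field_simp

theorem sqrt_mul_rpow_sq_mul_sqrt_pow {b y : ℝ} (hb : 0 < b) (hy : 0 ≤ y) :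
    √(y * b ^ (-1 / alphaExp (m + 1) + 1)) ^ 2 * √b ^ m = y * b := by
  rw [Real.sq_sqrt (by positivity), sqrt_pow_eq_rpow_one_div_alphaExp hb.le, mul_assoc,
    ← Real.rpow_add hb, neg_div, neg_add_cancel_comm, Real.rpow_one]

theorem tendsto_sqrt_mul_rpow_sq_mul_sqrt_pow_div (hβ : Tendsto β atTop atTop) :
    Tendsto (fun n : ℕ => √(n * β n ^ (-1 / alphaExp (m + 1) + 1)) ^ 2 * √(β n) ^ m / (n * β n))
      atTop (𝓝 1) := by
  refine tendsto_const_nhds.congr' ?_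
  filter_upwards [eventually_natCast_pos_and_pos hβ] with n ⟨hn, hβn⟩
  rw [sqrt_mul_rpow_sq_mul_sqrt_pow hβn hn.le, div_self (by positivity)]

theorem tendsto_sqrt_mul_rpow_div (hm : 1 ≤ m) (hβ : Tendsto β atTop atTop)
    (h : Tendsto (fun n : ℕ => β n ^ (1 + alphaExp (m + 1)) * (n : ℝ) ^ (-alphaExp (m + 1)))
      atTop atTop) :
    Tendsto (fun n : ℕ => √(n * β n ^ (-1 / alphaExp (m + 1) + 1)) / β n) atTop (𝓝 0) := by
  have hlim := ((tendsto_rpow_atTop (one_div_pos.2 (alphaExp_succ_pos hm))).comp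
    h).inv_tendsto_atTop.sqrt
  rw [Real.sqrt_zero] at hlim
  refine hlim.congr' ?_
  filter_upwards [eventually_natCast_pos_and_pos hβ] with n ⟨hn, hβn⟩
  have hroot : √(β n) ^ m ≠ 0 := by positivity
  rw [Pi.inv_apply, Function.comp, rpow_one_add_mul_rpow_neg_rpow_one_div_alphaExp hm hβn hn.le,
    ← Real.sqrt_sq (show 0 ≤ √(n * β n ^ (-1 / alphaExp (m + 1) + 1)) / β n by positivity),
    div_pow, eq_div_of_mul_eq hroot (sqrt_mul_rpow_sq_mul_sqrt_pow hβn hn.le)]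
  congr 1
  field_simp

end Rates

theorem theorem4p3_general {m : ℕ} (hm : 1 ≤ m)
    {Ω : Type*} [MeasurableSpace Ω] (P : Measure Ω) [IsProbabilityMeasure P]
    (q : USphere (m + 1))
    (ρ : USphere (m + 1) → ℝ) (hρ : IsBoundedDensity ρ)
    (hρ_diff : DifferentiableAt ℝ (radialExtension ρ) q) (hρ_pos : 0 < ρ q)
    (x : ℕ → Ω → USphere (m + 1))
    (hx_indep : iIndepFun x P) (hx_law : ∀ i, HasLaw (x i) (keyLaw ρ) P)
    (V : Matrix (Fin (m + 1)) (Fin (m + 1)) ℝ)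
    (α : ℝ) (hα : α = alphaExp (m + 1))
    (β : ℕ → ℝ) (hβ : Tendsto β atTop atTop)
    (hβ_sub : Tendsto (fun n : ℕ => β n * (n : ℝ) ^ (-α)) atTop (𝓝 0)) :
    (Tendsto (fun n : ℕ => β n ^ (1 + α) * (n : ℝ) ^ (-α)) atTop (𝓝 0) →
      TendstoInMeasure P
        (fun n ω => β n • attnDisplacement (β n) V q (fun i => x i ω) n) atTop
        (fun _ => Matrix.toEuclideanCLM (𝕜 := ℝ) V (attnDrift ρ q))) ∧
    (∀ τ : ℝ, 0 < τ →
      Tendsto (fun n : ℕ => β n ^ (1 + α) * (n : ℝ) ^ (-α)) atTop (𝓝 τ) →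
      TendstoInDistribution
        (fun n ω => β n • attnDisplacement (β n) V q (fun i => x i ω) n) atTop
        (fun g => Matrix.toEuclideanCLM (𝕜 := ℝ) V (attnDrift ρ q) + g)
        (fun _ => P)
        (multivariateGaussian 0 (τ ^ (1 / α) • (V * attnCov ρ q * V.transpose)))) ∧
    (Tendsto (fun n : ℕ => β n ^ (1 + α) * (n : ℝ) ^ (-α)) atTop atTop →
      TendstoInDistribution
        (fun n ω => Real.sqrt (n * β n ^ (-1 / α + 1)) •
          attnDisplacement (β n) V q (fun i => x i ω) n) atTop
        (fun g => g) (fun _ => P)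
        (multivariateGaussian 0 (V * attnCov ρ q * V.transpose))) ∧
    TendstoInMeasure P (fun n ω => attnDisplacement (β n) V q (fun i => x i ω) n) atTop
      (fun _ => 0) ∧
    TendstoInMeasure P (fun n ω => attnOutput (β n) V q (fun i => x i ω) n) atTop
      (fun _ => Matrix.toEuclideanCLM (𝕜 := ℝ) V (q : Euc (m + 1))) := by
  subst hα
  have hden := tendsto_sqrt_pow_div hm hβ hβ_sub
  have hone : Tendsto (fun n => β n / β n) atTop (𝓝 1) := tendsto_const_nhds.congr' <|
    (hβ.eventually_ne_atTop 0).mono fun n hn => (div_self hn).symm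
  have hinv : Tendsto (fun n => (1 : ℝ) / β n) atTop (𝓝 0) := hβ.const_div_atTop 1
  have hprob {c : ℕ → ℝ} {a : ℝ} :=
    tendstoInMeasure_smul_attnDisplacement (c := c) (a := a) hρ hρ_diff hρ_pos hx_indep hx_law V
      hβ hden
  have hdistr {c : ℕ → ℝ} {a b : ℝ} := tendstoInDistribution_smul_attnDisplacement (c := c)
    (a := a) (b := b) hρ hρ_diff hρ_pos hx_indep hx_law V hβ hden
  have hconsistent : TendstoInMeasure P
      (fun n ω => attnDisplacement (β n) V q (fun i => x i ω) n) atTop (fun _ => 0) := by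
    simpa using hprob (c := fun _ => 1) hinv
      (by simpa [div_mul_eq_div_div, ← div_eq_mul_inv] using hden.mul hinv)
  refine ⟨fun h => ?_, fun τ hτ h => ?_, fun h => ?_, hconsistent, ?_⟩
  · have hvar := tendsto_sq_mul_sqrt_pow_div hm hβ h
    rw [Real.zero_rpow (one_div_pos.2 (alphaExp_succ_pos hm)).ne'] at hvar
    simpa only [one_smul] using hprob hone hvar
  · simpa only [one_smul] using
      hdistr (Real.rpow_nonneg hτ.le _) hone (tendsto_sq_mul_sqrt_pow_div hm hβ h)
  · simpa only [one_smul, zero_smul, zero_add] using hdistr zero_le_one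
      (tendsto_sqrt_mul_rpow_div hm hβ h) (tendsto_sqrt_mul_rpow_sq_mul_sqrt_pow_div hβ)
  · intro ε hε
    simpa [attnDisplacement, edist_eq_enorm_sub] using hconsistent ε hε

/-- The ambient dimension is `d = m + 1 ≥ 2`. -/
theorem theorem4p3 {m : ℕ} (hm : 1 ≤ m)
    {Ω : Type*} [MeasurableSpace Ω] (P : Measure Ω) [IsProbabilityMeasure P]
    (q : USphere (m + 1))
    (ρ : USphere (m + 1) → ℝ) (hρ_nonneg : ∀ y, 0 ≤ ρ y)
    (hρ_smooth : ContMDiff (𝓡 m) 𝓘(ℝ, ℝ) 2 ρ) (hρ_pos : 0 < ρ q)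
    (x : ℕ → Ω → USphere (m + 1))
    (hx_indep : iIndepFun x P) (hx_law : ∀ i, HasLaw (x i) (keyLaw ρ) P)
    (V : Matrix (Fin (m + 1)) (Fin (m + 1)) ℝ)
    (α : ℝ) (hα : α = alphaExp (m + 1))
    (β : ℕ → ℝ) (hβ : Tendsto β atTop atTop)
    (hβ_sub : Tendsto (fun n : ℕ => β n * (n : ℝ) ^ (-α)) atTop (𝓝 0)) :
    -- drift dominated
    (Tendsto (fun n : ℕ => β n ^ (1 + α) * (n : ℝ) ^ (-α)) atTop (𝓝 0) →
      TendstoInMeasure P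
        (fun n ω => β n • attnDisplacement (β n) V q (fun i => x i ω) n) atTop
        (fun _ => Matrix.toEuclideanCLM (𝕜 := ℝ) V (attnDrift ρ q))) ∧
    -- mixed drift and fluctuation
    (∀ τ : ℝ, 0 < τ →
      Tendsto (fun n : ℕ => β n ^ (1 + α) * (n : ℝ) ^ (-α)) atTop (𝓝 τ) →
      TendstoInDistribution
        (fun n ω => β n • attnDisplacement (β n) V q (fun i => x i ω) n) atTop
        (fun g => Matrix.toEuclideanCLM (𝕜 := ℝ) V (attnDrift ρ q) + g)
        (fun _ => P)
        (multivariateGaussian 0 (τ ^ (1 / α) • (V * attnCov ρ q * V.transpose)))) ∧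
    -- fluctuation dominated
    (Tendsto (fun n : ℕ => β n ^ (1 + α) * (n : ℝ) ^ (-α)) atTop atTop →
      TendstoInDistribution
        (fun n ω => Real.sqrt (n * β n ^ (-1 / α + 1)) •
          attnDisplacement (β n) V q (fun i => x i ω) n) atTop
        (fun g => g) (fun _ => P)
        (multivariateGaussian 0 (V * attnCov ρ q * V.transpose))) ∧
    -- consistency, in every regime
    TendstoInMeasure P (fun n ω => attnDisplacement (β n) V q (fun i => x i ω) n) atTop
      (fun _ => 0) ∧
    TendstoInMeasure P (fun n ω => attnOutput (β n) V q (fun i => x i ω) n) atTop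
      (fun _ => Matrix.toEuclideanCLM (𝕜 := ℝ) V (q : Euc (m + 1))) :=
  theorem4p3_general hm P q ρ (isBoundedDensity_of_continuous hρ_smooth.continuous hρ_nonneg)
    (differentiableAt_radialExtension hρ_smooth two_ne_zero q) hρ_pos x hx_indep hx_law V α hα β
    hβ hβ_sub
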